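/- Fix $p\ge 1$. Let $n\to\infty$, $m=m_n\to\infty$ with $m_n<n$. Let $\tau_{m,n}>0$ with $\tau_{m,n}/m\to 0$, let $S_{m,n}$ be random $m\times n$ matrices, and let $X_n$ be deterministic $n\times p$ matrices with (for all large $n$) a singular value decomposition $X_n=U_nL_nV_n^\top$, where $U_n^\top U_n=I_p$, $V_n=(v_{n,1},\dots,v_{n,p})$ is orthogonal and $L_n=\mathrm{diag}(\ell_{n,1},\dots,\ell_{n,p})$ with $\ell_{n,1}\ge\dots\ge\ell_{n,p}>0$. Assume the global relative eigengap condition $$\limsup_{n\to\infty}\frac{\ell_{n,1}}{\ell_{n,p}}<\infty,\qquad \liminf_{n\to\infty}\min_{1\le i\le p-1}\frac{\ell_{n,i}}{\ell_{n,i+1}}>1$$ (a minimum over the empty set being $+\infty$). *Notation.* $\lambda_i(\Xi)$ is the $i$-th largest eigenvalue of a symmetric matrix $\Xi$; $\Lambda_{n,i}=\lambda_i(X_n^\top X_n)$, and $\hat\Lambda_{m,n,i}=\lambda_i(X_n^\top S_{m,n}^\top S_{m,n}X_n)$. Thus $v_{n,i}$ is a unit eigenvector of $X_n^\top X_n$ for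 $\Lambda_{n,i}$. Let $\hat v_{m,n,i}$ be random unit eigenvectors of $X_n^\top S_{m,n}^\top S_{m,n}X_n$ for $\hat\Lambda_{m,n,i}$. We say that the *signs of $v_{n,k}$ and $\hat v_{m,n,k}$ agree* if, for all large $n$, almost surely, $v_{n,k}^\top\hat v_{m,n,k}\ge 0$; or if, for all large $n$, almost surely, the first non-zero coordinate of each of $v_{n,k}$, $\hat v_{m,n,k}$ is positive, and moreover $\liminf_n|(v_{n,k})_1|>0$. Rows and columns of $p^2\times p^2$ matrices are indexed by pairs $(i,j)\in\{1,\dots,p\}^2$; $\mathrm{vec}(A)_{(ij)}=A_{ij}$, and $D_p$ is the $p^2\times\frac{p(p+1)}2$ matrix $(D_p)_{(ij),(kl)}=\delta_{ik}\delta_{jl}$, $k\le l$, so that $D_p^\top$ extracts the upper triangle. A positive semidefinite $p^2\times p^2$ matrix $G$ is *absolutely symmetric* if $G_{(ij),(kl)}=G_{(ij),(lk)}=G_{(ji),(kl)}=G_{(ji),(lk)}$ for all $i,j,k,l$ and $D_p^\top GD_p$ is positive definite. For a positive semidefinite $p\times p$ matrix $\Xi$ with distinct eigenvalues and unit eigenvectors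 $v_k(\Xi)$, let $$\Delta_i(\Xi,G)=\sum_{k\ne i,\,l\ne i}\frac{\lambda_i(\Xi)\sqrt{\lambda_k(\Xi)\lambda_l(\Xi)}}{(\lambda_i(\Xi)-\lambda_k(\Xi))(\lambda_i(\Xi)-\lambda_l(\Xi))}\,G_{(ik),(il)}\,v_k(\Xi)v_l(\Xi)^\top;$$ if $\Xi$ has a repeated eigenvalue, $(c^\top\Delta_i(\Xi,G)c)^{-1/2}:=0$. **General case.** Suppose that there are absolutely symmetric $p^2\times p^2$ matrices $G_n$ and $0<c_0<C_0<\infty$ with $c_0I\preceq D_p^\top G_nD_p\preceq C_0I$ for all $n$ and $$\sqrt m\,(\tau_{m,n}D_p^\top G_nD_p)^{-1/2}D_p^\top\mathrm{vec}(U_n^\top S_{m,n}^\top S_{m,n}U_n-I_p)\Rightarrow\mathcal N(0,I_{p(p+1)/2}).$$ Then for every $i\in\{1,\dots,p\}$, $$\sqrt{\frac{m}{\tau_{m,n}(G_n)_{(ii),(ii)}}}\;\hat\Lambda_{m,n,i}^{-1}(\hat\Lambda_{m,n,i}-\Lambda_{n,i})\Rightarrow\mathcal N(0,1).$$ Moreover,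 let $\Delta_{n,i}=\Delta_i(X_n^\top X_n,G_n)$, computed with $v_k(X_n^\top X_n)=v_{n,k}$, and let $\hat\Delta_{m,n,i}=\Delta_i(X_n^\top S_{m,n}^\top S_{m,n}X_n,G_n)$, computed with the eigenvectors $\hat v_{m,n,k}$. If for every $k$ the signs of $v_{n,k}$ and $\hat v_{m,n,k}$ agree, then for every unit vector $c\in\mathbb R^p$ with $\liminf_n c^\top\Delta_{n,i}c>0$, $$\sqrt m\,\tau_{m,n}^{-1/2}\,(c^\top\hat\Delta_{m,n,i}c)^{-1/2}\,c^\top(\hat v_{m,n,i}-v_{n,i})\Rightarrow\mathcal N(0,1).$$ **Special case.** Let $\alpha\in\{0,1\}$, let $(P_p)_{(ij),(kl)}=\delta_{il}\delta_{jk}$ and $Q_p=\mathrm{vec}(I_p)\mathrm{vec}(I_p)^\top$, and suppose instead that $$\sqrt m\,\tau_{m,n}^{-1/2}\,\mathrm{vec}(U_n^\top S_{m,n}^\top S_{m,n}U_n-I_p)\Rightarrow\mathcal N(0,I_{p^2}+P_p+\alpha Q_p).$$ Then for every $i\in\{1,\dots,p\}$, $$\sqrt{\frac{m}{(2+\alpha)\tau_{m,n}}}\;\hat\Lambda_{m,n,i}^{-1}(\hat\Lambda_{m,n,i}-\Lambda_{n,i})\Rightarrow\mathcal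 N(0,1),$$ and if the signs of $v_{n,i}$ and $\hat v_{m,n,i}$ agree, then for every unit vector $c\in\mathbb R^p$ with $\limsup_n(c^\top v_{n,i})^2<1$, $$\sqrt{\frac m{\tau_{m,n}}}\left(\sum_{k\ne i}\frac{\hat\Lambda_{m,n,i}\hat\Lambda_{m,n,k}}{(\hat\Lambda_{m,n,i}-\hat\Lambda_{m,n,k})^2}(c^\top\hat v_{m,n,k})^2\right)^{-1/2}c^\top(\hat v_{m,n,i}-v_{n,i})\Rightarrow\mathcal N(0,1).$$ -/

import Mathlib

open Filter Topology MeasureTheory ProbabilityTheory Matrix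
open scoped MatrixOrder

noncomputable section

namespace SketchedPCA

/-- `X = U diag(ℓ) Vᵀ` is a singular value decomposition of the `n × p` matrix `X`, with `U` having
orthonormal columns, `V` orthogonal, and positive singular values in non-increasing order. -/
structure IsSVD {n p : ℕ} (X U : Matrix (Fin n) (Fin p) ℝ) (ℓ : Fin p → ℝ)
    (V : Matrix (Fin p) (Fin p) ℝ) : Prop where
  eq : X = U * Matrix.diagonal ℓ * Vᵀ
  left_orth : Uᵀ * U = 1
  right_orth : Vᵀ * V = 1
  antitone : Antitone ℓ
  pos : ∀ i, 0 < ℓ i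

/-- The ratio of the largest to the smallest singular value has a finite limit superior. -/
def BoundedConditionNumber {p : ℕ} [NeZero p] (ℓ : ℕ → Fin p → ℝ) : Prop :=
  limsup (fun n => ((ℓ n ⊥ / ℓ n ⊤ : ℝ) : EReal)) atTop < ⊤

/-- The singular values have bounded condition number, and the minimum over `i` of the ratios of
consecutive singular values has limit inferior greater than one. The minimum over the empty set
(`p = 1`) is `+∞`. -/
def GlobalRelativeEigengap {p : ℕ} [NeZero p] (ℓ : ℕ → Fin p → ℝ) : Prop :=
  BoundedConditionNumber ℓ ∧
    1 < liminf (fun n => ⨅ (i : Fin p) (j : Fin p) (_ : (i : ℕ) + 1 = (j : ℕ)),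
      ((ℓ n i / ℓ n j : ℝ) : EReal)) atTop

/-- Vectorization of a square matrix, the entries being labelled by pairs `(i, j)`. -/
def pairVec {p : ℕ} (A : Matrix (Fin p) (Fin p) ℝ) : Fin p × Fin p → ℝ := fun q => A q.1 q.2

/-- The `p (p + 1) / 2` index pairs of the upper triangle of a `p × p` matrix. -/
abbrev UpperIdx (p : ℕ) : Type := {q : Fin p × Fin p // q.1 ≤ q.2}

/-- The matrix `D_p` of the upper triangulation operator:
`(D_p)_{(ij),(kl)} = δ_{ik} δ_{jl}` with `k ≤ l`. -/
def upperTri (p : ℕ) : Matrix (Fin p × Fin p) (UpperIdx p) ℝ :=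
  Matrix.of fun ij kl => if ij.1 = kl.1.1 ∧ ij.2 = kl.1.2 then 1 else 0

/-- Absolutely symmetric matrices. -/
structure AbsolutelySymmetric {p : ℕ} (G : Matrix (Fin p × Fin p) (Fin p × Fin p) ℝ) : Prop where
  posSemidef : G.PosSemidef
  swap_right : ∀ i j k l, G (i, j) (k, l) = G (i, j) (l, k)
  swap_left : ∀ i j k l, G (i, j) (k, l) = G (j, i) (k, l)
  posDef : ((upperTri p)ᵀ * G * upperTri p).PosDef

/-- `Q_p = vec(I_p) vec(I_p)ᵀ`. -/
def Qmat (p : ℕ) : Matrix (Fin p × Fin p) (Fin p × Fin p) ℝ :=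
  Matrix.vecMulVec (pairVec (1 : Matrix (Fin p) (Fin p) ℝ)) (pairVec (1 : Matrix (Fin p) (Fin p) ℝ))

/-- The transposition matrix, `(P_p)_{(ij),(kl)} = δ_{il} δ_{jk}`. -/
def Pmat (p : ℕ) : Matrix (Fin p × Fin p) (Fin p × Fin p) ℝ :=
  Matrix.of fun ij kl => if ij.1 = kl.2 ∧ ij.2 = kl.1 then 1 else 0

/-- The `i`-th largest eigenvalue (with multiplicity) of a symmetric matrix `Ξ`; the value `0` for
non-symmetric `Ξ` plays no role. -/
def eig {p : ℕ} (Ξ : Matrix (Fin p) (Fin p) ℝ) (i : Fin p) : ℝ :=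
  if h : Ξ.IsHermitian then h.eigenvalues₀ (Fin.cast (Fintype.card_fin p).symm i) else 0

/-- The sketched Gram matrix `Xᵀ Sᵀ S X`. -/
def sketchedGram {m n p : ℕ} (S : Matrix (Fin m) (Fin n) ℝ) (X : Matrix (Fin n) (Fin p) ℝ) :
    Matrix (Fin p) (Fin p) ℝ :=
  Xᵀ * Sᵀ * S * X

/-- `w` is a unit eigenvector of `Ξ` for its `i`-th largest eigenvalue. -/
def IsUnitEigenvector {p : ℕ} (Ξ : Matrix (Fin p) (Fin p) ℝ) (i : Fin p) (w : Fin p → ℝ) : Prop :=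
  w ⬝ᵥ w = 1 ∧ Ξ *ᵥ w = eig Ξ i • w

/-- The matrix `Δ_i(Ξ, G)`, where `w k` is the chosen unit eigenvector of `Ξ` for its `k`-th
largest eigenvalue. -/
def Delta {p : ℕ} (Ξ : Matrix (Fin p) (Fin p) ℝ) (w : Fin p → Fin p → ℝ)
    (G : Matrix (Fin p × Fin p) (Fin p × Fin p) ℝ) (i : Fin p) : Matrix (Fin p) (Fin p) ℝ :=
  ∑ k ∈ Finset.univ.filter (fun k => k ≠ i), ∑ l ∈ Finset.univ.filter (fun l => l ≠ i),
    (eig Ξ i * √(eig Ξ k * eig Ξ l) / ((eig Ξ i - eig Ξ k) * (eig Ξ i - eig Ξ l))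
      * G (i, k) (i, l)) • Matrix.vecMulVec (w k) (w l)

open Classical in
/-- `(cᵀ Δ_i(Ξ, G) c)^{-1/2}`, which by convention is `0` if `Ξ` has a repeated eigenvalue
(where `Δ_i` is formally `∞ · I_p`). -/
def invSqrtDelta {p : ℕ} (Ξ : Matrix (Fin p) (Fin p) ℝ) (w : Fin p → Fin p → ℝ)
    (G : Matrix (Fin p × Fin p) (Fin p × Fin p) ℝ) (i : Fin p) (c : Fin p → ℝ) : ℝ :=
  if Function.Injective (eig Ξ) then (√(c ⬝ᵥ Delta Ξ w G i *ᵥ c))⁻¹ else 0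

/-- The first non-zero coordinate of the vector is positive. -/
def FirstNonzeroPos {p : ℕ} (w : Fin p → ℝ) : Prop :=
  ∃ k, 0 < w k ∧ ∀ j < k, w j = 0

section Random

variable {p : ℕ} {Ω : ℕ → Type*} [∀ n, MeasurableSpace (Ω n)] (P : ∀ n, Measure (Ω n))

/-- Consistent resolution of the sign ambiguity between deterministic vectors `v n` and random
vectors `vhat n`: either the sign of `vhat n` is the one that makes its inner product with `v n`
non-negative, or both vectors have a positive first non-zero coordinate, and this normalization is
asymptotically non-degenerate in that the first coordinate of `v n` stays away from zero. -/
def SignsAgree [NeZero p] (v : ℕ → Fin p → ℝ) (vhat : ∀ n, Ω n → Fin p → ℝ) : Prop :=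
  (∀ᶠ n in atTop, ∀ᵐ ω ∂(P n), 0 ≤ v n ⬝ᵥ vhat n ω) ∨
  ((∀ᶠ n in atTop, FirstNonzeroPos (v n) ∧ ∀ᵐ ω ∂(P n), FirstNonzeroPos (vhat n ω)) ∧
    0 < liminf (fun n => ((|v n 0| : ℝ) : EReal)) atTop)

variable [∀ n, IsProbabilityMeasure (P n)]

/-- The real random variables `T n` converge in distribution to `N(0, 1)`. -/
def ConvStdNormal (T : ∀ n, Ω n → ℝ) : Prop :=
  TendstoInDistribution T atTop (id : ℝ → ℝ) P (gaussianReal 0 1)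

/-- Asymptotic normality of the symmetric quadratic form `Uᵀ Sᵀ S U - I_p` with covariance
matrices `G n`: each `G n` is absolutely symmetric, `c I ⪯ D_pᵀ G_n D_p ⪯ C I` for some
`0 < c < C < ∞`, and
`√m (τ D_pᵀ G_n D_p)^{-1/2} D_pᵀ vec(Uᵀ Sᵀ S U - I_p)` converges in distribution to
the standard normal law on `ℝ^{p(p+1)/2}`. -/
structure SymNormality (m : ℕ → ℕ) (τ : ℕ → ℝ) (S : ∀ n, Ω n → Matrix (Fin (m n)) (Fin n) ℝ)
    (U : ∀ n, Matrix (Fin n) (Fin p) ℝ)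
    (G : ℕ → Matrix (Fin p × Fin p) (Fin p × Fin p) ℝ) : Prop where
  absSymm : ∀ n, AbsolutelySymmetric (G n)
  bounds : ∃ c C : ℝ, 0 < c ∧ c < C ∧ ∀ n,
    c • (1 : Matrix (UpperIdx p) (UpperIdx p) ℝ) ≤ (upperTri p)ᵀ * G n * upperTri p ∧
    (upperTri p)ᵀ * G n * upperTri p ≤ C • (1 : Matrix (UpperIdx p) (UpperIdx p) ℝ)
  conv : TendstoInDistribution
    (fun n ω => (WithLp.toLp 2 (√(m n : ℝ) •
      ((CFC.sqrt (τ n • ((upperTri p)ᵀ * G n * upperTri p)))⁻¹ *ᵥ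
        ((upperTri p)ᵀ *ᵥ pairVec (sketchedGram (S n ω) (U n) - 1))) ) :
      EuclideanSpace ℝ (UpperIdx p)))
    atTop (id : EuclideanSpace ℝ (UpperIdx p) → EuclideanSpace ℝ (UpperIdx p)) P
    (stdGaussian (EuclideanSpace ℝ (UpperIdx p)))

/-- The special case of asymptotic normality of `Uᵀ Sᵀ S U - I_p` with the constant covariance
`G = I + P_p + α Q_p`: the vectors `√m τ^{-1/2} vec(Uᵀ Sᵀ S U - I_p)` converge in distribution
to `N(0, G)`. -/
def SymNormalityIso (m : ℕ → ℕ) (τ : ℕ → ℝ) (S : ∀ n, Ω n → Matrix (Fin (m n)) (Fin n) ℝ)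
    (U : ∀ n, Matrix (Fin n) (Fin p) ℝ) (α : ℝ) : Prop :=
  TendstoInDistribution
    (fun n ω => (WithLp.toLp 2 ((√(m n : ℝ) * (√(τ n))⁻¹) •
      pairVec (sketchedGram (S n ω) (U n) - 1)) : EuclideanSpace ℝ (Fin p × Fin p)))
    atTop (id : EuclideanSpace ℝ (Fin p × Fin p) → EuclideanSpace ℝ (Fin p × Fin p)) P
    (multivariateGaussian 0 (1 + Pmat p + α • Qmat p))

end Random

end SketchedPCA

end

open SketchedPCA

noncomputable section

namespace SketchedPCA

/-! ### Compactness along ultrafilters. -/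

section Ultrafilter

variable {α : Type*}

/-! Write `a = √(m/τ)`, which tends to infinity, `K = Uᵀ Sᵀ S U` and `W = a (K - 1)`, the scaled
error. The singular value decomposition gives `Xᵀ Sᵀ S X = ℓ₁² V diag(ρ) K diag(ρ) Vᵀ`, where `ρ`
lists the singular values divided by the largest one. The common scale `ℓ₁²` cancels from every
statistic. The eigengap condition makes every limit point of `ρ` positive and strictly decreasing,
so simple-spectrum perturbation theory applies uniformly although `X` itself may not converge.

To first order, the `i`-th eigenvalue of `diag(ρ) K diag(ρ)` has relative error `W_ii / a`, and the
`k`-th coordinate of `Vᵀ v̂_i` is `± a⁻¹ ρ_i ρ_k / (ρ_i² - ρ_k²) W_ki` for `k ≠ i`, while its `i`-th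
coordinate is `±1` up to `o(1/a)` (`eigen_expansion`, transferred to the model in
`sketched_expansion`). Sign agreement makes the sign `+1` (`sign_eq_one`). Hence each statistic
equals a bounded linear functional `B n ⬝ᵥ W n` plus a negligible error, with `B n` normalized so
that its variance under the covariance `G n` is one.

Both normality hypotheses imply that all such functionals are asymptotically standard normal
(`LinearCLT`). Negligibility of the error is checked by a compactness argument
(`LinearCLT.convStdNormal`): along an ultrafilter on pairs `(n, ω)` with `n → ∞` on which `W` stays
bounded, the quantities `W`, `ρ`, `V` and `G` all converge, and it suffices that the statistic and
the functional have the same limit. Tightness of `W` and characteristic functions turn this into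
convergence in distribution. The plug-in variance is handled by the same limits
(`tendsto_dotProduct_Delta_mulVec`). For `G = 1 + P_p + α Q_p`, the block of `G` relevant to the
eigenvector is an identity matrix, so signs of the other eigenvectors do not matter. -/

lemma exists_tendsto_of_eventually_abs_le {𝒰 : Ultrafilter α} {f : α → ℝ} {K : ℝ}
    (h : ∀ᶠ x in 𝒰, |f x| ≤ K) : ∃ L, Tendsto f 𝒰 (𝓝 L) := by
  have h' : ((𝒰.map f : Ultrafilter ℝ) : Filter ℝ) ≤ 𝓟 (Set.Icc (-K) K) := by
    rw [le_principal_iff, Ultrafilter.mem_coe, Ultrafilter.mem_map]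
    filter_upwards [h] with x hx using abs_le.mp hx
  obtain ⟨L, -, hL⟩ := isCompact_Icc.ultrafilter_le_nhds _ h'
  exact ⟨L, hL⟩

/-- If no bound worked, `|f|` would be unbounded on every set of `l`, and some ultrafilter below `l`
would send `|f|` to infinity, contradicting the finite limit. -/
lemma exists_eventually_abs_le_of_ultrafilter {l : Filter α} {f : α → ℝ}
    (h : ∀ 𝒰 : Ultrafilter α, (𝒰 : Filter α) ≤ l → ∃ L, Tendsto f 𝒰 (𝓝 L)) :
    ∃ K, ∀ᶠ x in l, |f x| ≤ K := by
  by_contra! hcon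
  have hne : (l ⊓ comap (fun x => |f x|) atTop).NeBot := by
    rw [((l.basis_sets).inf (atTop_basis.comap _)).neBot_iff]
    rintro ⟨s, K⟩ ⟨hs, -⟩
    by_contra hemp
    rw [Set.not_nonempty_iff_eq_empty] at hemp
    refine hcon K ?_
    filter_upwards [hs] with x hx
    by_contra hK
    have : x ∈ (s ∩ (fun x => |f x|) ⁻¹' Set.Ici K) := ⟨hx, hK.le⟩
    simp only [id] at hemp
    rw [hemp] at this
    exact this
  obtain ⟨𝒰, h𝒰⟩ := exists_ultrafilter_le (l ⊓ comap (fun x => |f x|) atTop)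
  obtain ⟨L, hL⟩ := h 𝒰 (h𝒰.trans inf_le_left)
  have h1 : Tendsto (fun x => |f x|) 𝒰 atTop :=
    tendsto_comap.mono_left (h𝒰.trans inf_le_right)
  exact not_tendsto_nhds_of_tendsto_atTop h1 _ hL.abs

lemma abs_apply_le_one_of_transpose_mul_self {n p : Type*} [Fintype n] [Fintype p] [DecidableEq p]
    {Q : Matrix n p ℝ} (hQ : Qᵀ * Q = 1) (i : n) (j : p) : |Q i j| ≤ 1 := by
  have h := congrFun (congrFun hQ j) j
  rw [mul_apply, one_apply_eq] at h
  have h2 : Q i j * Q i j ≤ 1 := by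
    rw [← h]
    exact Finset.single_le_sum (f := fun k => Qᵀ j k * Q k j)
      (fun k _ => mul_self_nonneg (Q k j)) (Finset.mem_univ i)
  exact abs_le.mpr ⟨by nlinarith, by nlinarith⟩

/-- Compactness of the orthogonal group: entries are bounded by one, and the defining equation is
closed. -/
lemma exists_tendsto_orthogonal {p : ℕ} {𝒰 : Ultrafilter α} {Q : α → Matrix (Fin p) (Fin p) ℝ}
    (hQ : ∀ᶠ x in 𝒰, (Q x)ᵀ * Q x = 1) :
    ∃ Q₀, Tendsto Q 𝒰 (𝓝 Q₀) ∧ Q₀ᵀ * Q₀ = 1 := by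
  have h : ∀ i j, ∃ L, Tendsto (fun x => Q x i j) 𝒰 (𝓝 L) := fun i j =>
    exists_tendsto_of_eventually_abs_le (K := 1)
      (hQ.mono fun x hx => abs_apply_le_one_of_transpose_mul_self hx i j)
  choose Q₀ hQ₀ using h
  have hlim : Tendsto Q 𝒰 (𝓝 (Matrix.of Q₀)) :=
    tendsto_pi_nhds.mpr fun i => tendsto_pi_nhds.mpr fun j => hQ₀ i j
  refine ⟨Matrix.of Q₀, hlim, ?_⟩
  have h2 : Tendsto (fun x => (Q x)ᵀ * Q x) 𝒰 (𝓝 ((Matrix.of Q₀)ᵀ * Matrix.of Q₀)) :=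
    ((by fun_prop : Continuous fun M : Matrix (Fin p) (Fin p) ℝ => Mᵀ * M).tendsto _).comp hlim
  exact tendsto_nhds_unique h2 (tendsto_const_nhds.congr' (hQ.mono fun x hx => hx.symm))

end Ultrafilter

/-! ### Ordered eigenvalues: diagonalization, continuity, measurability. -/

section Eig

variable {p : ℕ}

lemma isHermitian_conj_diagonal (Q : Matrix (Fin p) (Fin p) ℝ) (μ : Fin p → ℝ) :
    (Q * diagonal μ * Qᵀ).IsHermitian := by
  rw [Matrix.IsHermitian, conjTranspose_eq_transpose_of_trivial]
  simp [Matrix.mul_assoc]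

lemma eig_antitone (Ξ : Matrix (Fin p) (Fin p) ℝ) : Antitone (eig Ξ) := by
  unfold eig
  split_ifs with h
  · intro i j hij
    exact h.eigenvalues₀_antitone (by simpa using hij)
  · exact antitone_const

open Polynomial in
/-- The ordered eigenvalues can be read off any orthogonal diagonalization. -/
lemma eig_conj_diagonal {Q : Matrix (Fin p) (Fin p) ℝ} (hQ : Qᵀ * Q = 1) {μ : Fin p → ℝ}
    (hμ : Antitone μ) : eig (Q * diagonal μ * Qᵀ) = μ := by
  have hH := isHermitian_conj_diagonal Q μ
  have hroots : (Q * diagonal μ * Qᵀ).charpoly.roots = Multiset.map μ Finset.univ.val := by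
    rw [charpoly_mul_comm, ← Matrix.mul_assoc, hQ, Matrix.one_mul, charpoly_diagonal,
      Polynomial.roots_prod _ _ (by simp [Finset.prod_ne_zero_iff, Polynomial.X_sub_C_ne_zero])]
    simp
  have h1 := hH.sort_roots_charpoly_eq_eigenvalues₀
  have h2 : ((Q * diagonal μ * Qᵀ).charpoly.roots.map RCLike.re).sort (· ≥ ·) = List.ofFn μ := by
    rw [hroots, Fin.univ_val_map]
    simp only [Multiset.map_coe, List.map_ofFn, Multiset.coe_sort]
    apply List.mergeSort_of_pairwise
    simp_rw [decide_eq_true_eq, ← List.sortedGE_iff_pairwise]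
    exact hμ.sortedGE_ofFn
  rw [h2] at h1
  funext i
  rw [eig, dif_pos hH]
  have h3 := List.ofFn_congr (Fintype.card_fin p) hH.eigenvalues₀
  rw [h3] at h1
  have h4 := List.ofFn_injective h1
  rw [congrFun h4 i]

/-- The spectral theorem with eigenvalues in non-increasing order. -/
lemma exists_eq_conj_diagonal_eig {Ξ : Matrix (Fin p) (Fin p) ℝ} (h : Ξ.IsHermitian) :
    ∃ Q : Matrix (Fin p) (Fin p) ℝ, Qᵀ * Q = 1 ∧ Ξ = Q * diagonal (eig Ξ) * Qᵀ := by
  -- `eigenvalues` is the decreasing list `eigenvalues₀` reindexed by an unspecified equivalence;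
  -- `e` undoes this, so that permuting the columns of the eigenvector matrix by `e` puts the
  -- spectrum in order.
  set e : Fin p ≃ Fin p := (finCongr (Fintype.card_fin p).symm).trans
    (Fintype.equivOfCardEq (Fintype.card_fin _)) with he
  have heig : eig Ξ = h.eigenvalues ∘ e := by
    funext i
    rw [eig, dif_pos h, Function.comp_apply, Matrix.IsHermitian.eigenvalues, he]
    simp
  set R : Matrix (Fin p) (Fin p) ℝ := (h.eigenvectorUnitary).1 with hR
  have hRR : Rᵀ * R = 1 := by
    have := Unitary.coe_star_mul_self h.eigenvectorUnitary
    rwa [star_eq_conjTranspose, conjTranspose_eq_transpose_of_trivial] at this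
  have hspec : Ξ = R * diagonal h.eigenvalues * Rᵀ := by
    conv_lhs => rw [h.spectral_theorem]
    rw [Unitary.conjStarAlgAut_apply, star_eq_conjTranspose, conjTranspose_eq_transpose_of_trivial]
    rfl
  refine ⟨R.submatrix id e, ?_, ?_⟩
  · rw [transpose_submatrix, ← submatrix_mul _ _ _ _ _ Function.bijective_id, hRR]
    exact submatrix_one_equiv e
  · rw [heig, ← submatrix_diagonal_equiv, transpose_submatrix,
      submatrix_mul_equiv, submatrix_mul_equiv]
    exact hspec

/-- The ordered eigenvalues are continuous on symmetric matrices. -/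
lemma tendsto_eig {α : Type*} {l : Filter α} {Ξ : α → Matrix (Fin p) (Fin p) ℝ}
    {Ξ₀ : Matrix (Fin p) (Fin p) ℝ} (hΞ : ∀ x, (Ξ x).IsHermitian) (h : Tendsto Ξ l (𝓝 Ξ₀)) :
    Tendsto (fun x => eig (Ξ x)) l (𝓝 (eig Ξ₀)) := by
  rw [tendsto_iff_ultrafilter]
  intro 𝒰 h𝒰
  -- The diagonalizing matrices need not converge, but they do along the ultrafilter. Their limit
  -- diagonalizes `Ξ₀` with entries still in decreasing order, which identifies the limit of the
  -- spectrum.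
  choose Q hQ hΞQ using fun x => exists_eq_conj_diagonal_eig (hΞ x)
  obtain ⟨Q₀, hlim, hQ₀⟩ := exists_tendsto_orthogonal (𝒰 := 𝒰) (Q := Q) (.of_forall hQ)
  have hd : ∀ x, (Q x)ᵀ * Ξ x * Q x = diagonal (eig (Ξ x)) := fun x => by
    conv_lhs => rw [hΞQ x]
    calc _ = ((Q x)ᵀ * Q x) * diagonal (eig (Ξ x)) * ((Q x)ᵀ * Q x) := by
          simp only [Matrix.mul_assoc]
      _ = _ := by rw [hQ x, Matrix.one_mul, Matrix.mul_one]
  have h2 : Tendsto (fun x => diagonal (eig (Ξ x))) 𝒰 (𝓝 (Q₀ᵀ * Ξ₀ * Q₀)) := by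
    have hp : Tendsto (fun x => (Q x, Ξ x)) 𝒰 (𝓝 (Q₀, Ξ₀)) :=
      hlim.prodMk_nhds (h.mono_left h𝒰)
    have hc : Continuous fun M : Matrix (Fin p) (Fin p) ℝ × Matrix (Fin p) (Fin p) ℝ =>
      M.1ᵀ * M.2 * M.1 := by fun_prop
    exact ((hc.tendsto _).comp hp).congr hd
  set μ : Fin p → ℝ := fun k => (Q₀ᵀ * Ξ₀ * Q₀) k k with hμ
  have h3 : ∀ i j, Tendsto (fun x => diagonal (eig (Ξ x)) i j) 𝒰 (𝓝 ((Q₀ᵀ * Ξ₀ * Q₀) i j)) :=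
    fun i j => tendsto_pi_nhds.mp (tendsto_pi_nhds.mp h2 i) j
  have h4 : ∀ k, Tendsto (fun x => eig (Ξ x) k) 𝒰 (𝓝 (μ k)) := fun k => by
    simpa using h3 k k
  have hdiag : Q₀ᵀ * Ξ₀ * Q₀ = diagonal μ := by
    ext i j
    by_cases hij : i = j
    · subst hij; simp [hμ]
    · rw [diagonal_apply_ne _ hij]
      exact tendsto_nhds_unique (h3 i j) (by simp [diagonal_apply_ne _ hij])
  have hanti : Antitone μ := fun i j hij =>
    le_of_tendsto_of_tendsto' (h4 j) (h4 i) fun x => eig_antitone _ hij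
  have hQ₀' : Q₀ * Q₀ᵀ = 1 := mul_eq_one_comm.mp hQ₀
  have hfin : Ξ₀ = Q₀ * diagonal μ * Q₀ᵀ := by
    rw [← hdiag]
    calc Ξ₀ = (Q₀ * Q₀ᵀ) * Ξ₀ * (Q₀ * Q₀ᵀ) := by rw [hQ₀', Matrix.one_mul, Matrix.mul_one]
      _ = _ := by simp only [Matrix.mul_assoc]
  have : eig Ξ₀ = μ := by
    rw [hfin]; exact eig_conj_diagonal hQ₀ hanti
  rw [this]
  exact tendsto_pi_nhds.mpr h4

lemma eig_smul_conj {V M : Matrix (Fin p) (Fin p) ℝ} (hV : Vᵀ * V = 1) (hM : M.IsHermitian)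
    {s : ℝ} (hs : 0 ≤ s) : eig (s • (V * M * Vᵀ)) = s • eig M := by
  obtain ⟨Q, hQ, hMQ⟩ := exists_eq_conj_diagonal_eig hM
  have h1 : s • (V * M * Vᵀ) = (V * Q) * diagonal (s • eig M) * (V * Q)ᵀ := by
    conv_lhs => rw [hMQ]
    rw [diagonal_smul, transpose_mul]
    simp only [Matrix.mul_assoc, Matrix.mul_smul, Matrix.smul_mul]
  rw [h1]
  refine eig_conj_diagonal ?_ fun i j hij => mul_le_mul_of_nonneg_left (eig_antitone M hij) hs
  rw [transpose_mul, Matrix.mul_assoc, ← Matrix.mul_assoc Vᵀ, hV, Matrix.one_mul, hQ]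

lemma exists_isUnitEigenvector {Ξ : Matrix (Fin p) (Fin p) ℝ} (h : Ξ.IsHermitian) (i : Fin p) :
    ∃ w, IsUnitEigenvector Ξ i w := by
  obtain ⟨Q, hQ, hΞ⟩ := exists_eq_conj_diagonal_eig h
  refine ⟨Q.col i, ?_, ?_⟩
  · simpa [mul_apply, dotProduct, Matrix.col] using congrFun (congrFun hQ i) i
  · conv_lhs => rw [hΞ, ← mulVec_single_one, mulVec_mulVec, Matrix.mul_assoc, Matrix.mul_assoc,
      hQ, Matrix.mul_one, ← mulVec_mulVec, diagonal_mulVec_single, mul_one]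
    ext k
    simp [Matrix.mulVec_single, Matrix.col, mul_comm]

/-- The ordered eigenvalues of a random symmetric matrix are random variables. -/
lemma aemeasurable_eig {Ω : Type*} [MeasurableSpace Ω] {μ : Measure Ω}
    {A : Ω → Matrix (Fin p) (Fin p) ℝ} (hA : ∀ ω, (A ω).IsHermitian)
    (hm : ∀ i j, AEMeasurable (fun ω => A ω i j) μ) (k : Fin p) :
    AEMeasurable (fun ω => eig (A ω) k) μ := by
  -- Symmetrizing first makes this continuous on all matrices, whereas `eig` drops to `0` off the
  -- symmetric ones.
  set f : (Fin p → Fin p → ℝ) → ℝ := fun M => eig ((2⁻¹ : ℝ) • (of M + (of M)ᵀ)) k with hf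
  have hcont : Continuous f := by
    rw [continuous_iff_continuousAt]
    intro M
    have h1 : Continuous fun M : Fin p → Fin p → ℝ => (2⁻¹ : ℝ) • (of M + (of M)ᵀ) := by
      have : Continuous fun M : Fin p → Fin p → ℝ => of M := continuous_id
      fun_prop
    refine tendsto_pi_nhds.mp (tendsto_eig (fun M => ?_) (h1.tendsto M)) k
    rw [Matrix.IsHermitian, conjTranspose_eq_transpose_of_trivial]
    rw [transpose_smul, transpose_add, transpose_transpose, add_comm]
  have h2 : (fun ω => eig (A ω) k) = fun ω => f (fun i j => A ω i j) := by
    funext ω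
    have : (2⁻¹ : ℝ) • (of (fun i j => A ω i j) + (of fun i j => A ω i j)ᵀ) = A ω := by
      have h3 := hA ω
      rw [Matrix.IsHermitian, conjTranspose_eq_transpose_of_trivial] at h3
      have h4 : (of fun i j => A ω i j) = A ω := rfl
      rw [h4, h3, ← two_smul ℝ, smul_smul]
      norm_num
    simp only [hf, this]
  rw [h2]
  exact hcont.measurable.comp_aemeasurable
    (aemeasurable_pi_lambda _ fun i => aemeasurable_pi_lambda _ fun j => hm i j)

end Eig

/-! ### Convergence in distribution through characteristic functions. -/

section Distribution

variable {Ω : ℕ → Type*} [∀ n, MeasurableSpace (Ω n)] (P : ∀ n, Measure (Ω n))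
  [∀ n, IsProbabilityMeasure (P n)]

lemma norm_exp_mul_I_sub_le (a b : ℝ) :
    ‖Complex.exp (a * Complex.I) - Complex.exp (b * Complex.I)‖ ≤ |a - b| := by
  have h : Complex.exp (a * Complex.I) - Complex.exp (b * Complex.I) =
      Complex.exp (b * Complex.I) * (Complex.exp (Complex.I * ((a - b : ℝ) : ℂ)) - 1) := by
    rw [mul_sub, ← Complex.exp_add, mul_one]
    congr 2
    push_cast
    ring
  rw [h, norm_mul, Complex.norm_exp_ofReal_mul_I, one_mul]
  exact Real.norm_exp_I_mul_ofReal_sub_one_le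

lemma norm_exp_mul_I_sub_le_two (a b : ℝ) :
    ‖Complex.exp (a * Complex.I) - Complex.exp (b * Complex.I)‖ ≤ 2 := by
  refine (norm_sub_le _ _).trans ?_
  rw [Complex.norm_exp_ofReal_mul_I, Complex.norm_exp_ofReal_mul_I]
  norm_num

/-- The bounded-in-probability control `N` reduces convergence in probability of `T - Y` to
estimates on the events `N ≤ M`. -/
lemma tendsto_integral_exp_sub {l : Filter ℕ} {T Y N : ∀ n, Ω n → ℝ}
    (hT : ∀ n, AEMeasurable (T n) (P n)) (hY : ∀ n, AEMeasurable (Y n) (P n))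
    (hN : ∀ n, AEMeasurable (N n) (P n))
    (htight : ∀ δ > 0, ∃ M, ∀ᶠ n in l, (P n).real {ω | M < N n ω} ≤ δ)
    (h : ∀ M, ∀ ε > 0, ∀ᶠ n in l, ∀ᵐ ω ∂(P n), N n ω ≤ M → |T n ω - Y n ω| ≤ ε) (t : ℝ) :
    Tendsto (fun n => (∫ ω, Complex.exp (((t * T n ω : ℝ) : ℂ) * Complex.I) ∂(P n)) -
      ∫ ω, Complex.exp (((t * Y n ω : ℝ) : ℂ) * Complex.I) ∂(P n)) l (𝓝 0) := by
  rw [Metric.tendsto_nhds]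
  intro ε hε
  -- The event `N > M` costs at most `2 · ε/8`, since the exponentials differ by at most `2`; its
  -- complement costs at most `ε/4`, since they differ by at most `|t| |T - Y|`.
  obtain ⟨M, hM⟩ := htight (ε / 8) (by positivity)
  filter_upwards [hM, h M (ε / (4 * (|t| + 1))) (by positivity)] with n hn1 hn2
  have hint : ∀ f : Ω n → ℝ, AEMeasurable f (P n) →
      Integrable (fun ω => Complex.exp (((t * f ω : ℝ) : ℂ) * Complex.I)) (P n) := fun f hf =>
    Integrable.of_bound (C := 1)
      (AEMeasurable.aestronglyMeasurable (by fun_prop))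
      (.of_forall fun ω => (Complex.norm_exp_ofReal_mul_I _).le)
  have hS : NullMeasurableSet {ω | M < N n ω} (P n) := nullMeasurableSet_lt (by fun_prop) (hN n)
  rw [dist_zero_right, ← integral_sub (hint _ (hT n)) (hint _ (hY n))]
  have hsmall : |t| * (ε / (4 * (|t| + 1))) ≤ ε / 4 := by
    have : |t| / (|t| + 1) ≤ 1 := by
      rw [div_le_one (by positivity)]; linarith
    calc |t| * (ε / (4 * (|t| + 1))) = (|t| / (|t| + 1)) * (ε / 4) := by
          field_simp
      _ ≤ 1 * (ε / 4) := by gcongr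
      _ = ε / 4 := one_mul _
  calc ‖∫ ω, (Complex.exp (((t * T n ω : ℝ) : ℂ) * Complex.I) -
        Complex.exp (((t * Y n ω : ℝ) : ℂ) * Complex.I)) ∂(P n)‖
      ≤ ∫ ω, (ε / 4 + {ω | M < N n ω}.indicator (fun _ => (2 : ℝ)) ω) ∂(P n) := by
        refine norm_integral_le_of_norm_le
          ((integrable_const _).add ((integrable_const _).indicator₀ hS)) ?_
        filter_upwards [hn2] with ω hω
        by_cases hω2 : M < N n ω
        · rw [Set.indicator_of_mem (by exact hω2)]
          have := norm_exp_mul_I_sub_le_two (t * T n ω) (t * Y n ω)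
          linarith
        · rw [Set.indicator_of_notMem (by exact hω2), add_zero]
          refine (norm_exp_mul_I_sub_le _ _).trans (le_trans ?_ hsmall)
          rw [← mul_sub, abs_mul]
          gcongr
          exact hω (not_lt.mp hω2)
    _ = ε / 4 + 2 * (P n).real {ω | M < N n ω} := by
        rw [integral_add (integrable_const _) ((integrable_const _).indicator₀ hS),
          integral_indicator₀ hS]
        simp [mul_comm]
    _ < ε := by linarith

/-- Lévy's continuity theorem. It reduces weak convergence to limits of numbers, which may be tested
along ultrafilters. -/
lemma convStdNormal_iff {T : ∀ n, Ω n → ℝ} : ConvStdNormal P T ↔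
    (∀ n, AEMeasurable (T n) (P n)) ∧ ∀ t : ℝ,
      Tendsto (fun n => ∫ ω, Complex.exp (((t * T n ω : ℝ) : ℂ) * Complex.I) ∂(P n)) atTop
        (𝓝 (Complex.exp (-(t : ℂ) ^ 2 / 2))) := by
  have key : ∀ hT : ∀ n, AEMeasurable (T n) (P n), ∀ t : ℝ, ∀ n,
      charFun ((P n).map (T n)) t =
        ∫ ω, Complex.exp (((t * T n ω : ℝ) : ℂ) * Complex.I) ∂(P n) := fun hT t n => by
    rw [charFun_apply_real, integral_map (hT n)
      (Measurable.aestronglyMeasurable (by fun_prop))]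
    simp
  have lim : ∀ t : ℝ, charFun ((gaussianReal 0 1).map id) t = Complex.exp (-(t : ℂ) ^ 2 / 2) :=
    fun t => by
    rw [Measure.map_id, charFun_gaussianReal]
    simp [neg_div]
  constructor
  · intro h
    refine ⟨h.forall_aemeasurable, fun t => ?_⟩
    have h2 := ProbabilityMeasure.tendsto_iff_tendsto_charFun.mp h.tendsto t
    simp only [ProbabilityMeasure.coe_mk, lim] at h2
    exact h2.congr fun n => key h.forall_aemeasurable t n
  · rintro ⟨hT, h⟩
    refine ⟨hT, aemeasurable_id, ProbabilityMeasure.tendsto_iff_tendsto_charFun.mpr fun t => ?_⟩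
    simp only [ProbabilityMeasure.coe_mk, lim]
    exact (h t).congr fun n => (key hT t n).symm

/-- Sequences that converge in distribution are bounded in probability. -/
lemma exists_measureReal_norm_gt_le {E : Type*} [NormedAddCommGroup E] [InnerProductSpace ℝ E]
    [FiniteDimensional ℝ E] [MeasurableSpace E] [BorelSpace E] {ν : Measure E}
    [IsProbabilityMeasure ν] {Z : ∀ n, Ω n → E} (hZ : TendstoInDistribution Z atTop id P ν)
    {δ : ℝ} (hδ : 0 < δ) : ∃ M, ∀ n, (P n).real {ω | M < ‖Z n ω‖} ≤ δ := by
  have : ∀ n, IsProbabilityMeasure ((P n).map (Z n)) := fun n =>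
    Measure.isProbabilityMeasure_map (hZ.forall_aemeasurable n)
  have h1 := ProbabilityMeasure.tendsto_iff_tendsto_charFun.mp hZ.tendsto
  simp only [ProbabilityMeasure.coe_mk, Measure.map_id] at h1
  -- Pointwise convergence of characteristic functions to a continuous one forces tightness of the
  -- whole sequence, so one `M` serves every `n`.
  have h2 : IsTightMeasureSet (Set.range fun n => (P n).map (Z n)) :=
    isTightMeasureSet_of_tendsto_charFun (f := charFun ν) (by fun_prop) h1
  have h3 := tendsto_measure_norm_gt_of_isTightMeasureSet h2
  have h4 := ENNReal.tendsto_atTop_zero.mp h3 (ENNReal.ofReal δ) (by simpa using hδ)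
  obtain ⟨M, hM⟩ := h4
  refine ⟨M, fun n => ?_⟩
  have h5 := hM M le_rfl
  rw [iSup_range] at h5
  have h6 := (le_iSup (fun n => (P n).map (Z n) {x | M < ‖x‖}) n).trans h5
  rw [Measure.map_apply_of_aemeasurable (hZ.forall_aemeasurable n)
    (measurableSet_lt measurable_const measurable_norm)] at h6
  exact ENNReal.toReal_le_of_le_ofReal hδ.le h6

/-- Projections of an asymptotically normal sequence onto varying bounded directions of unit
limiting variance are asymptotically standard normal. -/
lemma convStdNormal_inner {ι : Type*} [Fintype ι] [DecidableEq ι] {C : Matrix ι ι ℝ}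
    (hC : C.PosSemidef) {Z : ∀ n, Ω n → EuclideanSpace ℝ ι}
    (hZ : TendstoInDistribution Z atTop id P (multivariateGaussian 0 C))
    {u : ℕ → ι → ℝ} {K : ℝ} (hK : ∀ᶠ n in atTop, ∀ q, |u n q| ≤ K)
    (hu : ∀ᶠ n in atTop, u n ⬝ᵥ C *ᵥ u n = 1) :
    ConvStdNormal P (fun n ω => u n ⬝ᵥ (Z n ω).ofLp) := by
  have hmeas : ∀ (v : ι → ℝ) n, AEMeasurable (fun ω => v ⬝ᵥ (Z n ω).ofLp) (P n) := fun v n => by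
    have h1 : Measurable fun z : EuclideanSpace ℝ ι => v ⬝ᵥ z.ofLp := by
      unfold dotProduct; fun_prop
    exact h1.comp_aemeasurable (hZ.forall_aemeasurable n)
  rw [convStdNormal_iff]
  refine ⟨fun n => hmeas _ n, fun t => ?_⟩
  rw [tendsto_iff_ultrafilter]
  intro g hg
  have hex : ∀ q, ∃ L, Tendsto (fun n => u n q) g (𝓝 L) := fun q =>
    exists_tendsto_of_eventually_abs_le (hg (hK.mono fun n hn => hn q))
  choose v hv using hex
  -- Every limit direction has variance one, so the limiting characteristic function is the same for
  -- all ultrafilters even though `u n` need not converge.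
  have hvC : v ⬝ᵥ C *ᵥ v = 1 := by
    have h1 : Tendsto (fun n => u n ⬝ᵥ C *ᵥ u n) g (𝓝 (v ⬝ᵥ C *ᵥ v)) := by
      have hc : Continuous fun w : ι → ℝ => w ⬝ᵥ C *ᵥ w := by fun_prop
      exact (hc.tendsto v).comp (tendsto_pi_nhds.mpr hv)
    exact tendsto_nhds_unique h1 (tendsto_const_nhds.congr' (hg (hu.mono fun n hn => hn.symm)))
  have hsub := tendsto_integral_exp_sub P (l := g) (T := fun n ω => u n ⬝ᵥ (Z n ω).ofLp)
    (Y := fun n ω => v ⬝ᵥ (Z n ω).ofLp) (N := fun n ω => ‖Z n ω‖) (fun n => hmeas _ n)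
    (fun n => hmeas _ n) (fun n => (hZ.forall_aemeasurable n).norm)
    (fun δ hδ => (exists_measureReal_norm_gt_le P hZ hδ).imp fun M hM => .of_forall hM)
    (fun M ε hε => ?_) t
  · have hchar := ProbabilityMeasure.tendsto_iff_tendsto_charFun.mp hZ.tendsto
      (WithLp.toLp 2 (t • v))
    simp only [ProbabilityMeasure.coe_mk, Measure.map_id] at hchar
    rw [charFun_multivariateGaussian hC] at hchar
    have h2 : Tendsto (fun n => ∫ ω, Complex.exp (((t * (v ⬝ᵥ (Z n ω).ofLp) : ℝ) : ℂ) * Complex.I)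
        ∂(P n)) g (𝓝 (Complex.exp (-(t : ℂ) ^ 2 / 2))) := by
      have h3 := hchar.mono_left hg
      have e1 : Complex.exp (((inner ℝ (WithLp.toLp 2 (t • v)) (0 : EuclideanSpace ℝ ι) : ℝ) : ℂ)
          * Complex.I - ((((WithLp.toLp 2 (t • v) : EuclideanSpace ℝ ι).ofLp ⬝ᵥ
            C *ᵥ (WithLp.toLp 2 (t • v) : EuclideanSpace ℝ ι).ofLp) : ℝ) : ℂ) / 2)
          = Complex.exp (-(t : ℂ) ^ 2 / 2) := by
        simp only [inner_zero_right, smul_dotProduct, mulVec_smul, dotProduct_smul,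
          hvC, smul_eq_mul, mul_one]
        congr 1
        push_cast
        ring
      rw [e1] at h3
      refine h3.congr fun n => ?_
      rw [charFun_apply, integral_map (hZ.forall_aemeasurable n)
        (Measurable.aestronglyMeasurable (by fun_prop))]
      refine integral_congr_ae (.of_forall fun ω => ?_)
      simp only [EuclideanSpace.inner_eq_star_dotProduct, star_trivial, smul_dotProduct,
        smul_eq_mul]
    have h4 := hsub.add h2
    simpa using h4
  · have hM : Tendsto (fun n => (∑ q, |u n q - v q|) * M) g (𝓝 0) := by
      have : Tendsto (fun n => (∑ q, |u n q - v q|) * M) g (𝓝 ((∑ q : ι, |v q - v q|) * M)) :=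
        (tendsto_finsetSum _ fun q _ => ((hv q).sub_const _).abs).mul_const _
      simpa using this
    filter_upwards [hM.eventually_le_const hε] with n hn
    refine .of_forall fun ω hω => le_trans ?_ hn
    rw [← sub_dotProduct, Finset.sum_mul]
    refine (Finset.abs_sum_le_sum_abs _ _).trans (Finset.sum_le_sum fun q _ => ?_)
    rw [abs_mul]
    refine mul_le_mul_of_nonneg_left ?_ (abs_nonneg _)
    exact (PiLp.norm_apply_le (Z n ω) q).trans hω

end Distribution

/-! ### Central limit theorem for linear functionals, and the delta method. -/

section LinearCLT

variable {p : ℕ} {Ω : ℕ → Type*} [∀ n, MeasurableSpace (Ω n)] (P : ∀ n, Measure (Ω n))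
  [∀ n, IsProbabilityMeasure (P n)]

/-- The central limit theorem for all bounded linear functionals of `W n` that are normalized by
the covariance matrices `G n`. -/
def LinearCLT {ι : Type*} [Fintype ι] (W : ∀ n, Ω n → ι → ℝ) (G : ℕ → Matrix ι ι ℝ) : Prop :=
  ∀ B : ℕ → ι → ℝ, (∃ K, ∀ᶠ n in atTop, ∀ q, |B n q| ≤ K) →
    (∀ᶠ n in atTop, B n ⬝ᵥ G n *ᵥ B n = 1) → ConvStdNormal P (fun n ω => B n ⬝ᵥ W n ω)

/-- Uniformly bounded matrices with diagonal bounded away from zero. -/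
def UniformlyNondegenerate {ι : Type*} (G : ℕ → Matrix ι ι ℝ) : Prop :=
  ∃ c C : ℝ, 0 < c ∧ (∀ n q, c ≤ G n q q) ∧ ∀ n q r, |G n q r| ≤ C

lemma UniformlyNondegenerate.pos {ι : Type*} {G : ℕ → Matrix ι ι ℝ}
    (hG : UniformlyNondegenerate G) (n : ℕ) (q : ι) :
    0 < G n q q := by
  obtain ⟨c, C, hc, hcG, -⟩ := hG
  exact hc.trans_le (hcG n q)

lemma UniformlyNondegenerate.exists_abs_single_le {ι : Type*} [DecidableEq ι] {G : ℕ → Matrix ι ι ℝ}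
    (hG : UniformlyNondegenerate G) (q : ι) :
    ∃ K, ∀ᶠ n in (atTop : Filter ℕ), ∀ r,
      |(Pi.single q (√(G n q q))⁻¹ : ι → ℝ) r| ≤ K := by
  obtain ⟨c, C, hc, hcG, -⟩ := hG
  refine ⟨(√c)⁻¹, .of_forall fun n r => ?_⟩
  by_cases hr : r = q
  · subst hr
    rw [Pi.single_eq_same, abs_of_nonneg (by positivity)]
    gcongr
    exact hcG n r
  · rw [Pi.single_eq_of_ne hr, abs_zero]
    positivity

variable {P}
variable {ι : Type*} [Fintype ι] [DecidableEq ι] {W : ∀ n, Ω n → ι → ℝ} {G : ℕ → Matrix ι ι ℝ}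

lemma UniformlyNondegenerate.single_quadratic (hG : UniformlyNondegenerate G) (n : ℕ) (q : ι) :
    (Pi.single q (√(G n q q))⁻¹ : ι → ℝ) ⬝ᵥ G n *ᵥ Pi.single q (√(G n q q))⁻¹ = 1 := by
  have hpos := hG.pos n q
  have hcol : (G n *ᵥ Pi.single q (√(G n q q))⁻¹) q = G n q q * (√(G n q q))⁻¹ := by
    simp [mulVec, dotProduct_single]
  rw [single_dotProduct, hcol, mul_comm, mul_assoc, ← mul_inv, Real.mul_self_sqrt hpos.le]
  exact mul_inv_cancel₀ hpos.ne'

/-- A rescaled basis vector is an admissible direction. Measurability and tightness of `W`, which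
`LinearCLT` does not assert, are recovered from these coordinates. -/
lemma LinearCLT.coord (h : LinearCLT P W G) (hG : UniformlyNondegenerate G) (q : ι) :
    ConvStdNormal P (fun n ω => (√(G n q q))⁻¹ * W n ω q) := by
  have h1 := h _ (hG.exists_abs_single_le q) (.of_forall fun n => hG.single_quadratic n q)
  simpa only [single_dotProduct] using h1

lemma LinearCLT.aemeasurable (h : LinearCLT P W G) (hG : UniformlyNondegenerate G) (n : ℕ) :
    AEMeasurable (W n) (P n) := by
  refine aemeasurable_pi_lambda _ fun q => ?_
  have h1 := ((h.coord hG q).forall_aemeasurable n).const_mul (√(G n q q))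
  obtain ⟨c, C, hc, hcG, -⟩ := hG
  have hpos : 0 < G n q q := hc.trans_le (hcG n q)
  refine h1.congr (.of_forall fun ω => ?_)
  simp only
  rw [← mul_assoc, mul_inv_cancel₀ (Real.sqrt_pos.mpr hpos).ne', one_mul]

lemma LinearCLT.tight (h : LinearCLT P W G) (hG : UniformlyNondegenerate G) {δ : ℝ} (hδ : 0 < δ) :
    ∃ M, ∀ n, (P n).real {ω | M < ‖W n ω‖} ≤ δ := by
  have hδ' : 0 < δ / (Fintype.card ι + 1) := by positivity
  choose M hM using fun q => exists_measureReal_norm_gt_le P (h.coord hG q) hδ'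
  obtain ⟨c, C, hc, hcG, hCG⟩ := hG
  -- If every normalized coordinate is at most `M q`, each coordinate of `W` is at most `√C * |M
  -- q|`; the sum dominates them all, and a union bound finishes.
  refine ⟨∑ q, √C * |M q|, fun n => ?_⟩
  have hsub : {ω | ∑ q, √C * |M q| < ‖W n ω‖} ⊆
      ⋃ q, {ω | M q < ‖(√(G n q q))⁻¹ * W n ω q‖} := by
    intro ω hω
    by_contra hcon
    simp only [Set.mem_iUnion, Set.mem_ofPred_eq, not_exists, not_lt] at hcon hω
    refine absurd hω (not_lt.mpr ((pi_norm_le_iff_of_nonneg (by positivity)).mpr fun q => ?_))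
    have hpos : 0 < G n q q := hc.trans_le (hcG n q)
    have h2 := hcon q
    rw [norm_mul, Real.norm_eq_abs, abs_of_nonneg (by positivity),
      inv_mul_le_iff₀ (Real.sqrt_pos.mpr hpos)] at h2
    have hle : √(G n q q) ≤ √C := Real.sqrt_le_sqrt ((le_abs_self _).trans (hCG n q q))
    calc ‖W n ω q‖ ≤ √(G n q q) * M q := h2
      _ ≤ √(G n q q) * |M q| := by gcongr; exact le_abs_self _
      _ ≤ √C * |M q| := by gcongr
      _ ≤ ∑ q, √C * |M q| :=
          Finset.single_le_sum (f := fun q => √C * |M q|) (fun _ _ => by positivity)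
            (Finset.mem_univ q)
  calc (P n).real {ω | ∑ q, √C * |M q| < ‖W n ω‖}
      ≤ (P n).real (⋃ q, {ω | M q < ‖(√(G n q q))⁻¹ * W n ω q‖}) := measureReal_mono hsub
    _ ≤ ∑ q, (P n).real {ω | M q < ‖(√(G n q q))⁻¹ * W n ω q‖} := measureReal_iUnion_fintype_le _
    _ ≤ ∑ _q : ι, δ / (Fintype.card ι + 1) := Finset.sum_le_sum fun q _ => hM q n
    _ ≤ δ := by
        rw [Finset.sum_const, Finset.card_univ, nsmul_eq_mul, mul_div_assoc', div_le_iff₀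
          (by positivity)]
        nlinarith

/-- A delta method: statistics that agree with a normalized linear functional of `W n` in every
bounded limit are asymptotically standard normal. -/
lemma LinearCLT.convStdNormal (h : LinearCLT P W G) (hG : UniformlyNondegenerate G)
    {B : ℕ → ι → ℝ} (hB : ∃ K, ∀ᶠ n in atTop, ∀ q, |B n q| ≤ K)
    (hBG : ∀ᶠ n in atTop, B n ⬝ᵥ G n *ᵥ B n = 1) {T : ∀ n, Ω n → ℝ}
    (hT : ∀ n, AEMeasurable (T n) (P n)) {good : ∀ n, Ω n → Prop}
    (hgood : ∀ᶠ n in atTop, ∀ᵐ ω ∂(P n), good n ω)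
    (hlim : ∀ 𝒰 : Ultrafilter (Σ n, Ω n), Tendsto Sigma.fst (𝒰 : Filter (Σ n, Ω n)) atTop →
      (∀ᶠ x : Σ n, Ω n in (𝒰 : Filter (Σ n, Ω n)), good x.1 x.2) → ∀ w : ι → ℝ,
      Tendsto (fun x : Σ n, Ω n => W x.1 x.2) 𝒰 (𝓝 w) →
      ∃ L, Tendsto (fun x : Σ n, Ω n => T x.1 x.2) 𝒰 (𝓝 L) ∧
        Tendsto (fun x : Σ n, Ω n => B x.1 ⬝ᵥ W x.1 x.2) 𝒰 (𝓝 L)) :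
    ConvStdNormal P T := by
  have hY := (convStdNormal_iff P).mp (h B hB hBG)
  rw [convStdNormal_iff]
  refine ⟨hT, fun t => ?_⟩
  have hsub := tendsto_integral_exp_sub P (l := atTop) (T := T) (Y := fun n ω => B n ⬝ᵥ W n ω)
    (N := fun n ω => ‖W n ω‖) hT hY.1 (fun n => (h.aemeasurable hG n).norm)
    (fun δ hδ => (h.tight hG hδ).imp fun M hM => .of_forall hM) (fun M ε hε => ?_) t
  · simpa using hsub.add (hY.2 t)
  · have hF : Tendsto (fun x : Σ n, Ω n => T x.1 x.2 - B x.1 ⬝ᵥ W x.1 x.2)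
        (comap Sigma.fst atTop ⊓ 𝓟 {x : Σ n, Ω n | ‖W x.1 x.2‖ ≤ M ∧ good x.1 x.2}) (𝓝 0) := by
      rw [tendsto_iff_ultrafilter]
      intro 𝒰 h𝒰
      have hfst : Tendsto Sigma.fst (𝒰 : Filter (Σ n, Ω n)) atTop :=
        tendsto_comap.mono_left (h𝒰.trans inf_le_left)
      have hev : ∀ᶠ x in (𝒰 : Filter (Σ n, Ω n)), ‖W x.1 x.2‖ ≤ M ∧ good x.1 x.2 :=
        le_principal_iff.mp (h𝒰.trans inf_le_right)
      have hwex : ∀ q, ∃ L, Tendsto (fun x : Σ n, Ω n => W x.1 x.2 q) 𝒰 (𝓝 L) := fun q =>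
        exists_tendsto_of_eventually_abs_le (hev.mono fun x hx => (norm_le_pi_norm _ q).trans hx.1)
      choose w hw using hwex
      obtain ⟨L, h1, h2⟩ := hlim 𝒰 hfst (hev.mono fun x hx => hx.2) w (tendsto_pi_nhds.mpr hw)
      simpa using h1.sub h2
    have h3 : ∀ᶠ x in comap Sigma.fst atTop ⊓ 𝓟 {x : Σ n, Ω n | ‖W x.1 x.2‖ ≤ M ∧ good x.1 x.2},
        |T x.1 x.2 - B x.1 ⬝ᵥ W x.1 x.2| ≤ ε := by
      have := hF.abs
      rw [abs_zero] at this
      exact this.eventually_le_const hε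
    rw [eventually_inf_principal, eventually_comap] at h3
    filter_upwards [h3, hgood] with n hn hgn
    filter_upwards [hgn] with ω hω hM
    exact hn ⟨n, ω⟩ rfl ⟨hM, hω⟩

end LinearCLT

/-! ### From the normality hypotheses to `LinearCLT`. -/

section Covariance

/-- The measure also occurs in an instance argument, so the equality is used by substitution rather
than by rewriting. -/
lemma tendstoInDistribution_of_measure_eq {Ω : ℕ → Type*} [∀ n, MeasurableSpace (Ω n)]
    (P : ∀ n, Measure (Ω n)) [∀ n, IsProbabilityMeasure (P n)] {E : Type*} [TopologicalSpace E]
    [MeasurableSpace E] [OpensMeasurableSpace E] {Z : ∀ n, Ω n → E} {ν ν' : Measure E}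
    [IsProbabilityMeasure ν] [IsProbabilityMeasure ν'] (hν : ν = ν')
    (h : TendstoInDistribution Z atTop id P ν) : TendstoInDistribution Z atTop id P ν' := by
  subst hν
  exact h

variable {p : ℕ}

lemma sketchedGram_transpose {m n p : ℕ} (S : Matrix (Fin m) (Fin n) ℝ)
    (X : Matrix (Fin n) (Fin p) ℝ) : (sketchedGram S X)ᵀ = sketchedGram S X := by
  simp [sketchedGram, Matrix.mul_assoc]

lemma sketchedGram_isHermitian {m n p : ℕ} (S : Matrix (Fin m) (Fin n) ℝ)
    (X : Matrix (Fin n) (Fin p) ℝ) : (sketchedGram S X).IsHermitian := by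
  rw [Matrix.IsHermitian, conjTranspose_eq_transpose_of_trivial, sketchedGram_transpose]

lemma pairVec_sketchedGram_sub_one_swap {m n p : ℕ} (S : Matrix (Fin m) (Fin n) ℝ)
    (X : Matrix (Fin n) (Fin p) ℝ) (q : Fin p × Fin p) :
    pairVec (sketchedGram S X - 1) q.swap = pairVec (sketchedGram S X - 1) q := by
  have h : (sketchedGram S X - 1)ᵀ = sketchedGram S X - 1 := by
    rw [transpose_sub, sketchedGram_transpose, transpose_one]
  exact congrFun (congrFun h q.1) q.2

/-- The coefficients on the upper triangle of the linear functional `B` of a symmetric matrix. -/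
def foldUpper (B : Fin p × Fin p → ℝ) : UpperIdx p → ℝ := fun q =>
  if q.1.1 = q.1.2 then B q.1 else B q.1 + B q.1.swap

lemma upperTri_mulVec_apply (f : UpperIdx p → ℝ) (q : Fin p × Fin p) :
    (upperTri p *ᵥ f) q = if h : q.1 ≤ q.2 then f ⟨q, h⟩ else 0 := by
  simp only [mulVec, dotProduct, upperTri, of_apply, ite_mul, one_mul, zero_mul]
  split_ifs with h
  · rw [Finset.sum_eq_single ⟨q, h⟩]
    · simp
    · intro r _ hr
      rw [if_neg]
      rintro ⟨h1, h2⟩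
      exact hr (Subtype.ext (Prod.ext h1.symm h2.symm))
    · simp
  · refine Finset.sum_eq_zero fun r _ => if_neg ?_
    rintro ⟨h1, h2⟩
    exact h (h1 ▸ h2 ▸ r.2)

/-- On a symmetric array the entries `q` and `q.swap` carry the same value, so their coefficients
may be added and attached to the one in the upper triangle. -/
lemma upperTri_foldUpper_dotProduct (B v : Fin p × Fin p → ℝ) (hv : ∀ q, v q.swap = v q) :
    (upperTri p *ᵥ foldUpper B) ⬝ᵥ v = B ⬝ᵥ v := by
  have h1 : (upperTri p *ᵥ foldUpper B) ⬝ᵥ v = ∑ q : Fin p × Fin p,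
      ((if q.1 ≤ q.2 then B q * v q else 0) + if q.1 < q.2 then B q.swap * v q.swap else 0) := by
    refine Finset.sum_congr rfl fun q _ => ?_
    rw [upperTri_mulVec_apply, hv]
    rcases lt_trichotomy q.1 q.2 with h | h | h
    · simp [foldUpper, h, h.le, h.ne]; ring
    · simp [foldUpper, h]
    · simp [h.not_ge, h.not_gt]
  rw [h1, Finset.sum_add_distrib]
  have h2 : ∑ q : Fin p × Fin p, (if q.1 < q.2 then B q.swap * v q.swap else 0) =
      ∑ q : Fin p × Fin p, if q.2 < q.1 then B q * v q else 0 :=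
    Fintype.sum_equiv (Equiv.prodComm _ _) _ _ fun q => rfl
  rw [h2, ← Finset.sum_add_distrib]
  refine Finset.sum_congr rfl fun q _ => ?_
  by_cases h : q.1 ≤ q.2
  · simp [h]
  · simp [h, not_le.mp h]

/-- The rows and columns of `G` are invariant under swapping the two indices of a pair, so folding
is harmless on either side of `G`. -/
lemma foldUpper_quadratic {G : Matrix (Fin p × Fin p) (Fin p × Fin p) ℝ}
    (hG : AbsolutelySymmetric G) (B : Fin p × Fin p → ℝ) :
    foldUpper B ⬝ᵥ ((upperTri p)ᵀ * G * upperTri p) *ᵥ foldUpper B = B ⬝ᵥ G *ᵥ B := by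
  have h1 : G *ᵥ (upperTri p *ᵥ foldUpper B) = G *ᵥ B := by
    funext q
    rw [mulVec, mulVec, dotProduct_comm, dotProduct_comm _ B]
    exact upperTri_foldUpper_dotProduct B _ fun r => (hG.swap_right q.1 q.2 r.1 r.2).symm
  rw [← mulVec_mulVec, ← mulVec_mulVec, h1, mulVec_transpose, ← dotProduct_comm,
    ← dotProduct_mulVec, dotProduct_comm]
  refine upperTri_foldUpper_dotProduct B _ fun r => ?_
  rw [mulVec, mulVec]
  congr 1
  funext s
  exact (hG.swap_left r.1 r.2 s.1 s.2).symm

/-- Test positivity on the sum and the difference of two basis vectors. -/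
lemma _root_.Matrix.PosSemidef.two_mul_abs_apply_le {ι : Type*} [Fintype ι] [DecidableEq ι]
    {G : Matrix ι ι ℝ} (hG : G.PosSemidef) (q r : ι) : 2 * |G q r| ≤ G q q + G r r := by
  have hsym : G r q = G q r := by
    have := hG.isHermitian.apply q r
    simpa using this
  have hplus := hG.dotProduct_mulVec_nonneg (Pi.single q 1 + Pi.single r 1)
  have hminus := hG.dotProduct_mulVec_nonneg (Pi.single q 1 - Pi.single r 1)
  simp only [star_trivial, mulVec_add, mulVec_sub, add_dotProduct, dotProduct_add, sub_dotProduct,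
    dotProduct_sub, single_dotProduct, one_mul, mulVec_single_one, Matrix.col_apply,
    hsym] at hplus hminus
  have : 2 * |G q r| = |2 * G q r| := by rw [abs_mul, abs_two]
  rw [this, abs_le]
  constructor <;> linarith

/-- The Loewner bounds control the diagonal entries at upper-triangular pairs; swap invariance
extends this to all pairs, and positive semidefiniteness bounds the remaining entries. -/
lemma uniformlyNondegenerate_of_bounds {G : ℕ → Matrix (Fin p × Fin p) (Fin p × Fin p) ℝ}
    (hG : ∀ n, AbsolutelySymmetric (G n))
    (hb : ∃ c C : ℝ, 0 < c ∧ c < C ∧ ∀ n,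
      c • (1 : Matrix (UpperIdx p) (UpperIdx p) ℝ) ≤ (upperTri p)ᵀ * G n * upperTri p ∧
      (upperTri p)ᵀ * G n * upperTri p ≤ C • (1 : Matrix (UpperIdx p) (UpperIdx p) ℝ)) :
    UniformlyNondegenerate G := by
  obtain ⟨c, C, hc, hcC, h⟩ := hb
  have hentry : ∀ n (q : UpperIdx p), ((upperTri p)ᵀ * G n * upperTri p) q q = G n q.1 q.1 := by
    intro n q
    have hcol : upperTri p *ᵥ Pi.single q 1 = Pi.single q.1 1 := by
      funext r
      rw [upperTri_mulVec_apply]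
      by_cases hr : r = q.1
      · subst hr; simp [q.2]
      · rw [Pi.single_eq_of_ne hr]
        split_ifs with h
        · exact Pi.single_eq_of_ne (fun h' => hr (congrArg Subtype.val h')) _
        · rfl
    have h1 : ((upperTri p)ᵀ * G n * upperTri p) q q =
        Pi.single q 1 ⬝ᵥ ((upperTri p)ᵀ * G n * upperTri p) *ᵥ Pi.single q 1 := by
      simp [single_dotProduct]
    rw [h1, ← mulVec_mulVec, ← mulVec_mulVec, hcol, mulVec_transpose, ← dotProduct_comm,
      ← dotProduct_mulVec, hcol]
    simp
  have hdiag : ∀ n q, c ≤ G n q q ∧ G n q q ≤ C := by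
    have hup : ∀ n (q : UpperIdx p), c ≤ G n q.1 q.1 ∧ G n q.1 q.1 ≤ C := by
      intro n q
      have h1 := (Matrix.le_iff.mp (h n).1).diag_nonneg (i := q)
      have h2 := (Matrix.le_iff.mp (h n).2).diag_nonneg (i := q)
      simp only [Matrix.sub_apply, Matrix.smul_apply, one_apply_eq, smul_eq_mul, mul_one, hentry] at h1 h2
      constructor <;> linarith
    intro n q
    rcases le_total q.1 q.2 with hq | hq
    · exact hup n ⟨q, hq⟩
    · have h1 := hup n ⟨q.swap, hq⟩
      have h2 : G n q.swap q.swap = G n q q := by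
        rw [← Prod.mk.eta (p := q)]
        exact ((hG n).swap_left _ _ _ _).trans ((hG n).swap_right _ _ _ _)
      simpa only [h2] using h1
  refine ⟨c, C, hc, fun n q => (hdiag n q).1, fun n q r => ?_⟩
  have := (hG n).posSemidef.two_mul_abs_apply_le q r
  linarith [(hdiag n q).2, (hdiag n r).2]

/-- `P_p` is a symmetric involution, so `1 + P_p` is half its own square; `Q_p` is a rank-one
square. -/
lemma isotropic_posSemidef {α : ℝ} (hα : 0 ≤ α) : (1 + Pmat p + α • Qmat p).PosSemidef := by
  have hPP : Pmat p * Pmat p = 1 := by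
    ext q r
    rw [mul_apply, Finset.sum_eq_single q.swap]
    · simp only [Pmat, of_apply, one_apply, Prod.ext_iff, Prod.fst_swap, Prod.snd_swap, and_self,
        if_true, one_mul]
      by_cases h1 : q.1 = r.1 <;> by_cases h2 : q.2 = r.2 <;> simp [h1, h2]
    · intro s _ hs
      have : ¬(q.1 = s.2 ∧ q.2 = s.1) := fun h => hs (Prod.ext h.2.symm h.1.symm)
      simp [Pmat, this]
    · simp
  have hPT : (Pmat p)ᵀ = Pmat p := by
    ext q r
    simp only [Pmat, transpose_apply, of_apply]
    congr 1
    exact propext ⟨fun h => ⟨h.2.symm, h.1.symm⟩, fun h => ⟨h.2.symm, h.1.symm⟩⟩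
  have h1 : (1 + Pmat p).PosSemidef := by
    have h2 : (1 : Matrix (Fin p × Fin p) (Fin p × Fin p) ℝ) + Pmat p =
        (2⁻¹ : ℝ) • ((1 + Pmat p)ᴴ * (1 + Pmat p)) := by
      rw [conjTranspose_eq_transpose_of_trivial, transpose_add, transpose_one, hPT, mul_add,
        add_mul, add_mul, hPP]
      simp only [mul_one, one_mul]
      rw [show (1 + Pmat p + (Pmat p + 1)) = (2 : ℝ) • (1 + Pmat p) by rw [two_smul]; abel,
        smul_smul]
      norm_num
    rw [h2]
    exact (posSemidef_conjTranspose_mul_self _).smul (by norm_num)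
  refine h1.add (PosSemidef.smul ?_ hα)
  have := posSemidef_vecMulVec_self_star (pairVec (1 : Matrix (Fin p) (Fin p) ℝ))
  rwa [star_trivial] at this

lemma isotropic_apply (α : ℝ) (q r : Fin p × Fin p) :
    (1 + Pmat p + α • Qmat p) q r = (if q = r then 1 else 0) +
      (if q.1 = r.2 ∧ q.2 = r.1 then 1 else 0) +
      α * ((if q.1 = q.2 then 1 else 0) * (if r.1 = r.2 then 1 else 0)) := by
  simp [Pmat, Qmat, vecMulVec_apply, pairVec, one_apply]

lemma isotropic_uniformlyNondegenerate {α : ℝ} (hα : 0 ≤ α) :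
    UniformlyNondegenerate (fun _ : ℕ => 1 + Pmat p + α • Qmat p) := by
  refine ⟨1, 2 + α, one_pos, fun _ q => ?_, fun _ q r => ?_⟩
  · simp only [isotropic_apply, if_true]
    split_ifs <;> simp <;> linarith
  · simp only [isotropic_apply]
    split_ifs <;> simp <;> (try rw [abs_of_nonneg]) <;> linarith

variable {Ω : ℕ → Type*} [∀ n, MeasurableSpace (Ω n)] {P : ∀ n, Measure (Ω n)}
  [∀ n, IsProbabilityMeasure (P n)] {m : ℕ → ℕ} {τ : ℕ → ℝ}
  {S : ∀ n, Ω n → Matrix (Fin (m n)) (Fin n) ℝ} {U : ∀ n, Matrix (Fin n) (Fin p) ℝ}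

lemma SymNormalityIso.linearCLT {α : ℝ} (hα : 0 ≤ α) (h : SymNormalityIso P m τ S U α) :
    LinearCLT P (fun n ω => (√(m n : ℝ) * (√(τ n))⁻¹) • pairVec (sketchedGram (S n ω) (U n) - 1))
      (fun _ => 1 + Pmat p + α • Qmat p) := by
  rintro B ⟨K, hK⟩ hB
  exact convStdNormal_inner P (isotropic_posSemidef hα) h hK hB

lemma SymNormality.linearCLT {G : ℕ → Matrix (Fin p × Fin p) (Fin p × Fin p) ℝ}
    (hτ : ∀ n, 0 < τ n) (h : SymNormality P m τ S U G) :
    LinearCLT P (fun n ω => (√(m n : ℝ) * (√(τ n))⁻¹) • pairVec (sketchedGram (S n ω) (U n) - 1))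
      G := by
  rintro B - hB
  set H : ℕ → Matrix (UpperIdx p) (UpperIdx p) ℝ := fun n => (upperTri p)ᵀ * G n * upperTri p
    with hH
  set R : ℕ → Matrix (UpperIdx p) (UpperIdx p) ℝ := fun n => CFC.sqrt (τ n • H n) with hR
  have hpd : ∀ n, (τ n • H n).PosDef := fun n => (h.absSymm n).posDef.smul (hτ n)
  have hRR : ∀ n, R n * R n = τ n • H n := fun n =>
    CFC.sqrt_mul_sqrt_self _ (hpd n).posSemidef.nonneg
  have hRT : ∀ n, (R n)ᵀ = R n := fun n => by
    have h1 := (Matrix.nonneg_iff_posSemidef.mp (CFC.sqrt_nonneg (τ n • H n))).isHermitian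
    rwa [Matrix.IsHermitian, conjTranspose_eq_transpose_of_trivial] at h1
  have hRdet : ∀ n, IsUnit (R n).det := fun n => by
    have h1 := (Matrix.isUnit_iff_isUnit_det _).mp (hpd n).isUnit
    rw [← hRR n, det_mul] at h1
    exact isUnit_of_mul_isUnit_left h1
  -- Chosen so that pairing `u n` with the whitened vector cancels `R n` and leaves the functional
  -- `B n` of the scaled error. Since `R n * R n = τ n • H n`, its squared norm is the variance of
  -- `B n`, hence one; this also bounds its coordinates.
  set u : ℕ → UpperIdx p → ℝ := fun n => (√(τ n))⁻¹ • (R n *ᵥ foldUpper (B n)) with hu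
  have huu : ∀ n, u n ⬝ᵥ u n = B n ⬝ᵥ G n *ᵥ B n := fun n => by
    have hττ : (√(τ n))⁻¹ * ((√(τ n))⁻¹ * τ n) = 1 := by
      have := Real.mul_self_sqrt (hτ n).le
      have h0 := (Real.sqrt_pos.mpr (hτ n)).ne'
      rw [← mul_assoc, ← mul_inv, this, inv_mul_cancel₀ (hτ n).ne']
    rw [← foldUpper_quadratic (h.absSymm n), hu]
    simp only [smul_dotProduct, dotProduct_smul, smul_eq_mul]
    rw [dotProduct_mulVec, ← mulVec_transpose, mulVec_mulVec, hRT, hRR, smul_mulVec,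
      smul_dotProduct, dotProduct_comm, smul_eq_mul, ← mul_assoc, ← mul_assoc, mul_assoc _ _ (τ n),
      hττ, one_mul]
  have h1 := convStdNormal_inner P (C := 1) PosSemidef.one (u := u) (K := 1)
    (Z := fun n ω => (WithLp.toLp 2 (√(m n : ℝ) •
      ((CFC.sqrt (τ n • ((upperTri p)ᵀ * G n * upperTri p)))⁻¹ *ᵥ
        ((upperTri p)ᵀ *ᵥ pairVec (sketchedGram (S n ω) (U n) - 1)))))) ?_ ?_ ?_
  · convert! h1 using 3 with n ω
    have h2 : u n ⬝ᵥ ((R n)⁻¹ *ᵥ ((upperTri p)ᵀ *ᵥ pairVec (sketchedGram (S n ω) (U n) - 1))) =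
        (√(τ n))⁻¹ * (B n ⬝ᵥ pairVec (sketchedGram (S n ω) (U n) - 1)) := by
      rw [← upperTri_foldUpper_dotProduct (B n) _
        (pairVec_sketchedGram_sub_one_swap (S n ω) (U n)), hu]
      simp only [smul_dotProduct, smul_eq_mul]
      congr 1
      rw [dotProduct_comm, dotProduct_mulVec, ← mulVec_transpose, mulVec_mulVec, hRT,
        mul_nonsing_inv _ (hRdet n), one_mulVec, mulVec_transpose, ← dotProduct_mulVec,
        dotProduct_comm]
    show _ = u n ⬝ᵥ (√(m n : ℝ) • ((R n)⁻¹ *ᵥ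
      ((upperTri p)ᵀ *ᵥ pairVec (sketchedGram (S n ω) (U n) - 1))))
    rw [dotProduct_smul, dotProduct_smul, h2, smul_eq_mul, smul_eq_mul, mul_assoc]
  · exact tendstoInDistribution_of_measure_eq P multivariateGaussian_zero_one.symm h.conv
  · filter_upwards [hB] with n hn q
    rw [← huu] at hn
    have h2 : u n q * u n q ≤ 1 := by
      rw [← hn]
      exact Finset.single_le_sum (f := fun k => u n k * u n k)
        (fun k _ => mul_self_nonneg _) (Finset.mem_univ q)
    exact abs_le.mpr ⟨by nlinarith, by nlinarith⟩
  · filter_upwards [hB] with n hn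
    rw [one_mulVec, huu, hn]

end Covariance

/-! ### First-order perturbation of a diagonal matrix with simple spectrum. -/

section Perturbation

variable {α : Type*} {p : ℕ}

lemma diagonal_mul_mul_diagonal_isHermitian {K : Matrix (Fin p) (Fin p) ℝ} (hK : K.IsHermitian)
    (ρ : Fin p → ℝ) : (diagonal ρ * K * diagonal ρ).IsHermitian := by
  rw [Matrix.IsHermitian, conjTranspose_eq_transpose_of_trivial] at hK ⊢
  rw [transpose_mul, transpose_mul, diagonal_transpose, hK, Matrix.mul_assoc]

/-- Eigenvalues of a multiplicative perturbation of a diagonal matrix. -/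
lemma tendsto_eig_diagonal_mul {l : Filter α} {ρ : α → Fin p → ℝ} {ρ₀ : Fin p → ℝ}
    {K : α → Matrix (Fin p) (Fin p) ℝ} (hKH : ∀ x, (K x).IsHermitian)
    (hρ : Tendsto ρ l (𝓝 ρ₀)) (hK : Tendsto K l (𝓝 1)) (hpos : ∀ k, 0 < ρ₀ k)
    (hanti : StrictAnti ρ₀) (i : Fin p) :
    Tendsto (fun x => eig (diagonal (ρ x) * K x * diagonal (ρ x)) i) l (𝓝 (ρ₀ i ^ 2)) := by
  have hlim : Tendsto (fun x => diagonal (ρ x) * K x * diagonal (ρ x)) l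
      (𝓝 (diagonal ρ₀ * 1 * diagonal ρ₀)) := by
    have hc : Continuous fun q : (Fin p → ℝ) × Matrix (Fin p) (Fin p) ℝ =>
        diagonal q.1 * q.2 * diagonal q.1 := by fun_prop
    have hp : Tendsto (fun x => (ρ x, K x)) l (𝓝 (ρ₀, 1)) := hρ.prodMk_nhds hK
    have hcomp := (hc.tendsto (ρ₀, 1)).comp hp
    simpa only [Function.comp_def] using hcomp
  have h1 := tendsto_pi_nhds.mp (tendsto_eig
    (fun x => diagonal_mul_mul_diagonal_isHermitian (hKH x) (ρ x)) hlim) i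
  have h2 : eig (diagonal ρ₀ * 1 * diagonal ρ₀) = fun k => ρ₀ k ^ 2 := by
    have h3 := eig_conj_diagonal (Q := (1 : Matrix (Fin p) (Fin p) ℝ)) (by simp)
      (μ := fun k => ρ₀ k ^ 2) fun k l hkl =>
        pow_le_pow_left₀ (hpos l).le (hanti.antitone hkl) 2
    rw [← h3]
    congr 1
    simp [diagonal_mul_diagonal, pow_two]
  rwa [h2] at h1

/-- Splitting `K = 1 + (K - 1)` isolates the small part on the right. Everything in
`eigen_expansion` comes from multiplying this equation by `a` and passing to the limit. -/
lemma eigen_equation {ρ : Fin p → ℝ} {K : Matrix (Fin p) (Fin p) ℝ} {w : Fin p → ℝ} {μ : ℝ}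
    (h : (diagonal ρ * K * diagonal ρ) *ᵥ w = μ • w) (k : Fin p) :
    (μ - ρ k ^ 2) * w k = ρ k * ∑ l, (K - 1) k l * (ρ l * w l) := by
  have h1 := congrFun h k
  have h2 : ((diagonal ρ * K * diagonal ρ) *ᵥ w) k = ρ k * ∑ l, K k l * (ρ l * w l) := by
    simp only [mulVec, dotProduct, mul_diagonal, diagonal_mul, Finset.mul_sum]
    exact Finset.sum_congr rfl fun l _ => by ring
  rw [h2, Pi.smul_apply, smul_eq_mul] at h1
  have h3 : ∑ l, (K - 1) k l * (ρ l * w l) = ∑ l, K k l * (ρ l * w l) - ρ k * w k := by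
    simp only [Matrix.sub_apply, sub_mul, Finset.sum_sub_distrib]
    congr 1
    simp [one_apply]
  rw [h3, mul_sub, h1]
  ring

/-- First-order expansion of the eigenvalues and eigenvectors of `diag(ρ) K diag(ρ)` along an
ultrafilter on which `a (K - 1)` converges for some `a → ∞`. -/
lemma eigen_expansion {𝒰 : Ultrafilter α} {ρ : α → Fin p → ℝ} {ρ₀ : Fin p → ℝ}
    {K : α → Matrix (Fin p) (Fin p) ℝ} {W₀ : Fin p → Fin p → ℝ} {a : α → ℝ}
    (hKH : ∀ x, (K x).IsHermitian)
    (hρ : Tendsto ρ 𝒰 (𝓝 ρ₀)) (hpos : ∀ k, 0 < ρ₀ k) (hanti : StrictAnti ρ₀)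
    (ha : Tendsto a 𝒰 atTop)
    (hW : ∀ k l, Tendsto (fun x => a x * (K x - 1) k l) 𝒰 (𝓝 (W₀ k l)))
    {i : Fin p} {w : α → Fin p → ℝ} (hw1 : ∀ᶠ x in 𝒰, w x ⬝ᵥ w x = 1)
    (hw : ∀ᶠ x in 𝒰, (diagonal (ρ x) * K x * diagonal (ρ x)) *ᵥ w x =
      eig (diagonal (ρ x) * K x * diagonal (ρ x)) i • w x) :
    (∀ k, Tendsto (fun x => eig (diagonal (ρ x) * K x * diagonal (ρ x)) k) 𝒰 (𝓝 (ρ₀ k ^ 2))) ∧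
    Tendsto (fun x => a x * (eig (diagonal (ρ x) * K x * diagonal (ρ x)) i - ρ x i ^ 2)) 𝒰
      (𝓝 (ρ₀ i ^ 2 * W₀ i i)) ∧
    ∃ σ : ℝ, (σ = 1 ∨ σ = -1) ∧ Tendsto w 𝒰 (𝓝 (Pi.single i σ)) ∧
      (∀ k, k ≠ i → Tendsto (fun x => a x * w x k) 𝒰
        (𝓝 (σ * (ρ₀ i * ρ₀ k / (ρ₀ i ^ 2 - ρ₀ k ^ 2) * W₀ k i)))) ∧
      Tendsto (fun x => a x * (w x i - σ)) 𝒰 (𝓝 0) := by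
  have hKE : ∀ k l, Tendsto (fun x => (K x - 1) k l) 𝒰 (𝓝 0) := fun k l => by
    have h1 := (hW k l).div_atTop ha
    refine h1.congr' ?_
    filter_upwards [ha.eventually_gt_atTop 0] with x hx
    field_simp
  have hK : Tendsto K 𝒰 (𝓝 1) := by
    refine tendsto_pi_nhds.mpr fun k => tendsto_pi_nhds.mpr fun l => ?_
    simpa using (hKE k l).add_const ((1 : Matrix (Fin p) (Fin p) ℝ) k l)
  have hμ := tendsto_eig_diagonal_mul hKH hρ hK hpos hanti
  have hρk := tendsto_pi_nhds.mp hρ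
  have hgap : ∀ k, k ≠ i → ρ₀ i ^ 2 - ρ₀ k ^ 2 ≠ 0 := fun k hk h => by
    rw [sub_eq_zero, sq_eq_sq₀ (hpos i).le (hpos k).le] at h
    exact hk (hanti.injective h).symm
  have hwex : ∀ k, ∃ L, Tendsto (fun x => w x k) 𝒰 (𝓝 L) := fun k => by
    refine exists_tendsto_of_eventually_abs_le (K := 1) (hw1.mono fun x hx => ?_)
    have h2 : w x k * w x k ≤ 1 := by
      rw [← hx]
      exact Finset.single_le_sum (f := fun k => w x k * w x k)
        (fun k _ => mul_self_nonneg _) (Finset.mem_univ k)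
    exact abs_le.mpr ⟨by nlinarith, by nlinarith⟩
  choose w₀ hw₀ using hwex
  have hrhs : ∀ k, Tendsto (fun x => ρ x k * ∑ l, (a x * (K x - 1) k l) * (ρ x l * w x l)) 𝒰
      (𝓝 (ρ₀ k * ∑ l, W₀ k l * (ρ₀ l * w₀ l))) := fun k =>
    (hρk k).mul (tendsto_finsetSum _ fun l _ => (hW k l).mul ((hρk l).mul (hw₀ l)))
  have heq : ∀ k, ∀ᶠ x in 𝒰,
      a x * ((eig (diagonal (ρ x) * K x * diagonal (ρ x)) i - ρ x k ^ 2) * w x k) =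
        ρ x k * ∑ l, (a x * (K x - 1) k l) * (ρ x l * w x l) := fun k => by
    filter_upwards [hw] with x hx
    rw [eigen_equation hx k, mul_left_comm, Finset.mul_sum]
    simp only [mul_assoc]
  -- The right side of the eigenvalue equation is `O(1/a)` and the gap on the left has a nonzero
  -- limit, so off-diagonal coordinates vanish. The normalization then leaves only the sign `w₀ i`.
  have hw₀k : ∀ k, k ≠ i → w₀ k = 0 := fun k hk => by
    have h1 : Tendsto (fun x => (eig (diagonal (ρ x) * K x * diagonal (ρ x)) i - ρ x k ^ 2) * w x k)
        𝒰 (𝓝 ((ρ₀ i ^ 2 - ρ₀ k ^ 2) * w₀ k)) :=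
      ((hμ i).sub ((hρk k).pow 2)).mul (hw₀ k)
    have h2 : Tendsto (fun x => (eig (diagonal (ρ x) * K x * diagonal (ρ x)) i - ρ x k ^ 2) * w x k)
        𝒰 (𝓝 0) := by
      refine ((hrhs k).div_atTop ha).congr' ?_
      filter_upwards [heq k, ha.eventually_gt_atTop 0] with x hx hax
      rw [← hx]
      field_simp
    exact (mul_eq_zero.mp (tendsto_nhds_unique h1 h2)).resolve_left (hgap k hk)
  have hw₀eq : w₀ = Pi.single i (w₀ i) := by
    funext k
    by_cases hk : k = i
    · subst hk; simp
    · rw [Pi.single_eq_of_ne hk, hw₀k k hk]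
  have hσ : w₀ i = 1 ∨ w₀ i = -1 := by
    have h1 : Tendsto (fun x => w x ⬝ᵥ w x) 𝒰 (𝓝 (w₀ ⬝ᵥ w₀)) :=
      tendsto_finsetSum _ fun l _ => (hw₀ l).mul (hw₀ l)
    have h2 : w₀ ⬝ᵥ w₀ = 1 :=
      tendsto_nhds_unique h1 (tendsto_const_nhds.congr' (hw1.mono fun x hx => hx.symm))
    rw [hw₀eq, single_dotProduct, Pi.single_eq_same] at h2
    exact mul_self_eq_one_iff.mp h2
  have hσ0 : w₀ i ≠ 0 := by rcases hσ with h | h <;> rw [h] <;> norm_num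
  have hsum : ∀ k, ∑ l, W₀ k l * (ρ₀ l * w₀ l) = W₀ k i * (ρ₀ i * w₀ i) := fun k =>
    Finset.sum_eq_single i (fun l _ hl => by rw [hw₀k l hl]; ring) (by simp)
  simp only [hsum] at hrhs
  -- The same equation, multiplied by `a` and divided by the gap; in the sum on the right only the
  -- term `l = i` survives in the limit.
  have hak : ∀ k, k ≠ i → Tendsto (fun x => a x * w x k) 𝒰
      (𝓝 (w₀ i * (ρ₀ i * ρ₀ k / (ρ₀ i ^ 2 - ρ₀ k ^ 2) * W₀ k i))) := fun k hk => by
    have hd := (hμ i).sub ((hρk k).pow 2)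
    have h1 := (hrhs k).div hd (hgap k hk)
    have h2 : ρ₀ k * (W₀ k i * (ρ₀ i * w₀ i)) / (ρ₀ i ^ 2 - ρ₀ k ^ 2) =
        w₀ i * (ρ₀ i * ρ₀ k / (ρ₀ i ^ 2 - ρ₀ k ^ 2) * W₀ k i) := by ring
    rw [h2] at h1
    refine h1.congr' ?_
    filter_upwards [heq k, hd.eventually_ne (hgap k hk)] with x hx hne
    rw [Pi.div_apply, ← hx]
    field_simp
  refine ⟨hμ, ?_, w₀ i, hσ, ?_, hak, ?_⟩
  · have h1 := (hrhs i).div (hw₀ i) hσ0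
    have h2 : ρ₀ i * (W₀ i i * (ρ₀ i * w₀ i)) / w₀ i = ρ₀ i ^ 2 * W₀ i i := by
      field_simp
    rw [h2] at h1
    refine h1.congr' ?_
    filter_upwards [heq i, (hw₀ i).eventually_ne hσ0] with x hx hne
    rw [Pi.div_apply, ← hx]
    field_simp
  · rw [← hw₀eq]
    exact tendsto_pi_nhds.mpr hw₀
  · have h2σ : w₀ i + w₀ i ≠ 0 := by
      rw [← two_mul]; exact mul_ne_zero two_ne_zero hσ0
    have hd := (hw₀ i).add_const (w₀ i)
    -- Since `w` has norm one, `(w i - σ) (w i + σ) = -∑ (w k)²` over `k ≠ i`. After multiplication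
    -- by `a` each term is a convergent factor times one tending to zero.
    have h1 : Tendsto (fun x => -(∑ k ∈ Finset.univ.erase i, (a x * w x k) * w x k)) 𝒰 (𝓝 0) := by
      have h3 : Tendsto (fun x => -(∑ k ∈ Finset.univ.erase i, (a x * w x k) * w x k)) 𝒰
          (𝓝 (-(∑ k ∈ Finset.univ.erase i,
            (w₀ i * (ρ₀ i * ρ₀ k / (ρ₀ i ^ 2 - ρ₀ k ^ 2) * W₀ k i)) * w₀ k))) :=
        (tendsto_finsetSum _ fun k hk => (hak k (Finset.ne_of_mem_erase hk)).mul (hw₀ k)).neg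
      rwa [Finset.sum_eq_zero, neg_zero] at h3
      intro k hk
      rw [hw₀k k (Finset.ne_of_mem_erase hk), mul_zero]
    have h3 := h1.div hd h2σ
    rw [zero_div] at h3
    refine h3.congr' ?_
    filter_upwards [hw1, hd.eventually_ne h2σ] with x hx hne
    rw [Pi.div_apply, div_eq_iff hne]
    have h4 : w x i * w x i + ∑ k ∈ Finset.univ.erase i, w x k * w x k = 1 := by
      rw [← hx, dotProduct]
      exact Finset.add_sum_erase _ (fun k => w x k * w x k) (Finset.mem_univ i)
    have h5 : w₀ i * w₀ i = 1 := by rcases hσ with h | h <;> rw [h] <;> norm_num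
    have h6 : ∑ k ∈ Finset.univ.erase i, (a x * w x k) * w x k =
        a x * ∑ k ∈ Finset.univ.erase i, w x k * w x k := by
      rw [Finset.mul_sum]
      exact Finset.sum_congr rfl fun k _ => mul_assoc _ _ _
    rw [h6]
    linear_combination (-a x) * h4 + (a x) * h5

end Perturbation

/-! ### The sketched Gram matrix in the coordinates of the singular value decomposition. -/

section Model

variable {p : ℕ}

lemma IsSVD.eig_gram {n : ℕ} {X U : Matrix (Fin n) (Fin p) ℝ} {ℓ : Fin p → ℝ}
    {V : Matrix (Fin p) (Fin p) ℝ} (h : IsSVD X U ℓ V) (k : Fin p) :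
    eig (Xᵀ * X) k = ℓ k ^ 2 := by
  have h1 : Xᵀ * X = V * diagonal (fun k => ℓ k ^ 2) * Vᵀ := by
    have h2 : Xᵀ * X = V * diagonal ℓ * (Uᵀ * U) * diagonal ℓ * Vᵀ := by
      rw [h.eq]
      simp only [transpose_mul, transpose_transpose, diagonal_transpose, Matrix.mul_assoc]
    rw [h2, h.left_orth, Matrix.mul_one, Matrix.mul_assoc V, diagonal_mul_diagonal]
    simp only [pow_two]
  rw [h1, eig_conj_diagonal h.right_orth]
  exact fun i j hij => pow_le_pow_left₀ (h.pos j).le (h.antitone hij) 2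

lemma transpose_mulVec_dotProduct {V : Matrix (Fin p) (Fin p) ℝ} (hV : Vᵀ * V = 1)
    (c v : Fin p → ℝ) : (Vᵀ *ᵥ c) ⬝ᵥ (Vᵀ *ᵥ v) = c ⬝ᵥ v := by
  rw [dotProduct_mulVec, ← mulVec_transpose, transpose_transpose, mulVec_mulVec,
    mul_eq_one_comm.mp hV, one_mulVec]

section ScaledError

variable {Ω : ℕ → Type*} {m : ℕ → ℕ} {τ : ℕ → ℝ}
  {S : ∀ n, Ω n → Matrix (Fin (m n)) (Fin n) ℝ} {U : ∀ n, Matrix (Fin n) (Fin p) ℝ}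

/-- The scaled and vectorized sketching error `√(m / τ) vec(Uᵀ Sᵀ S U - I)`. -/
def scaledError (m : ℕ → ℕ) (τ : ℕ → ℝ) (S : ∀ n, Ω n → Matrix (Fin (m n)) (Fin n) ℝ)
    (U : ∀ n, Matrix (Fin n) (Fin p) ℝ) (n : ℕ) (ω : Ω n) : Fin p × Fin p → ℝ :=
  (√(m n : ℝ) * (√(τ n))⁻¹) • pairVec (sketchedGram (S n ω) (U n) - 1)

lemma tendsto_scaling_atTop (hm : Tendsto m atTop atTop) (hτ : ∀ n, 0 < τ n)
    (hτm : Tendsto (fun n => τ n / (m n : ℝ)) atTop (𝓝 0)) :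
    Tendsto (fun n => √(m n : ℝ) * (√(τ n))⁻¹) atTop atTop := by
  have h1 : Tendsto (fun n => τ n / (m n : ℝ)) atTop (𝓝[>] 0) := by
    refine tendsto_nhdsWithin_iff.mpr ⟨hτm, ?_⟩
    filter_upwards [hm.eventually_gt_atTop 0] with n hn
    exact div_pos (hτ n) (by exact_mod_cast hn)
  have h2 := Real.tendsto_sqrt_atTop.comp (tendsto_inv_nhdsGT_zero.comp h1)
  refine h2.congr fun n => ?_
  simp only [Function.comp_apply, inv_div]
  rw [Real.sqrt_div (Nat.cast_nonneg _), div_eq_mul_inv]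

lemma scaledError_limit_symm {𝒰 : Ultrafilter (Σ n, Ω n)} {w₀ : Fin p × Fin p → ℝ}
    (hW : Tendsto (fun x : Σ n, Ω n => scaledError m τ S U x.1 x.2) 𝒰 (𝓝 w₀)) (k l : Fin p) :
    w₀ (k, l) = w₀ (l, k) := by
  refine tendsto_nhds_unique (tendsto_pi_nhds.mp hW (k, l))
    ((tendsto_pi_nhds.mp hW (l, k)).congr fun x => ?_)
  simp only [scaledError, Pi.smul_apply]
  exact congrArg _ (pairVec_sketchedGram_sub_one_swap (S x.1 x.2) (U x.1) (k, l))

end ScaledError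

variable [NeZero p]

/-- Singular values relative to the largest one. -/
def relSV (ℓ : Fin p → ℝ) (k : Fin p) : ℝ := ℓ k / ℓ ⊥

/-- Dividing out the largest singular value leaves a diagonal factor confined to a compact range,
multiplying a matrix close to the identity. -/
lemma IsSVD.sketchedGram_eq {m n : ℕ} {X U : Matrix (Fin n) (Fin p) ℝ} {ℓ : Fin p → ℝ}
    {V : Matrix (Fin p) (Fin p) ℝ} (h : IsSVD X U ℓ V) (S : Matrix (Fin m) (Fin n) ℝ) :
    sketchedGram S X = (ℓ ⊥ ^ 2) •
      (V * (diagonal (relSV ℓ) * sketchedGram S U * diagonal (relSV ℓ)) * Vᵀ) := by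
  have h0 : diagonal ℓ = ℓ ⊥ • diagonal (relSV ℓ) := by
    rw [← diagonal_smul]
    congr 1
    funext k
    simp only [Pi.smul_apply, smul_eq_mul, relSV]
    rw [mul_div_cancel₀ _ (h.pos ⊥).ne']
  have h1 : sketchedGram S X = V * (diagonal ℓ * sketchedGram S U * diagonal ℓ) * Vᵀ := by
    conv_lhs => rw [h.eq]
    simp only [sketchedGram, transpose_mul, transpose_transpose, diagonal_transpose,
      Matrix.mul_assoc]
  rw [h1, h0]
  simp only [Matrix.smul_mul, Matrix.mul_smul, smul_smul, pow_two]

lemma IsSVD.eig_sketchedGram {m n : ℕ} {X U : Matrix (Fin n) (Fin p) ℝ} {ℓ : Fin p → ℝ}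
    {V : Matrix (Fin p) (Fin p) ℝ} (h : IsSVD X U ℓ V) (S : Matrix (Fin m) (Fin n) ℝ) (k : Fin p) :
    eig (sketchedGram S X) k =
      ℓ ⊥ ^ 2 * eig (diagonal (relSV ℓ) * sketchedGram S U * diagonal (relSV ℓ)) k := by
  rw [h.sketchedGram_eq S, eig_smul_conj h.right_orth
    (diagonal_mul_mul_diagonal_isHermitian (sketchedGram_isHermitian S U) _) (sq_nonneg _)]
  rfl

lemma IsSVD.rotated_eigenvector {m n : ℕ} {X U : Matrix (Fin n) (Fin p) ℝ} {ℓ : Fin p → ℝ}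
    {V : Matrix (Fin p) (Fin p) ℝ} (h : IsSVD X U ℓ V) {S : Matrix (Fin m) (Fin n) ℝ} {i : Fin p}
    {v : Fin p → ℝ} (hv : IsUnitEigenvector (sketchedGram S X) i v) :
    (Vᵀ *ᵥ v) ⬝ᵥ (Vᵀ *ᵥ v) = 1 ∧
    (diagonal (relSV ℓ) * sketchedGram S U * diagonal (relSV ℓ)) *ᵥ (Vᵀ *ᵥ v) =
      eig (diagonal (relSV ℓ) * sketchedGram S U * diagonal (relSV ℓ)) i • (Vᵀ *ᵥ v) := by
  refine ⟨by rw [transpose_mulVec_dotProduct h.right_orth, hv.1], ?_⟩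
  have h1 := hv.2
  rw [h.eig_sketchedGram S i, h.sketchedGram_eq S] at h1
  set M := diagonal (relSV ℓ) * sketchedGram S U * diagonal (relSV ℓ)
  have hs : ℓ ⊥ ^ 2 ≠ 0 := pow_ne_zero 2 (h.pos ⊥).ne'
  rw [smul_mulVec, mul_smul] at h1
  have h2 := smul_right_injective (Fin p → ℝ) hs h1
  have h3 := congrArg (fun u => Vᵀ *ᵥ u) h2
  simp only [mulVec_smul] at h3
  rw [← h3, mulVec_mulVec, mulVec_mulVec, ← Matrix.mul_assoc, ← Matrix.mul_assoc, h.right_orth,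
    Matrix.one_mul]

lemma IsSVD.ratio_eq {n : ℕ} {X U : Matrix (Fin n) (Fin p) ℝ} {ℓ : Fin p → ℝ}
    {V : Matrix (Fin p) (Fin p) ℝ} (h : IsSVD X U ℓ V) (i k : Fin p) :
    ℓ i * ℓ k / (ℓ i ^ 2 - ℓ k ^ 2) =
      relSV ℓ i * relSV ℓ k / (relSV ℓ i ^ 2 - relSV ℓ k ^ 2) := by
  have h0 := (h.pos ⊥).ne'
  have h1 : relSV ℓ i ^ 2 - relSV ℓ k ^ 2 = (ℓ i ^ 2 - ℓ k ^ 2) / ℓ ⊥ ^ 2 := by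
    simp only [relSV]; ring
  have h2 : relSV ℓ i * relSV ℓ k = (ℓ i * ℓ k) / ℓ ⊥ ^ 2 := by
    simp only [relSV]; ring
  rw [h1, h2, div_div_div_cancel_right₀ (pow_ne_zero 2 h0)]

lemma GlobalRelativeEigengap.exists_condition_le {ℓ : ℕ → Fin p → ℝ}
    (hB : GlobalRelativeEigengap ℓ) : ∃ C, ∀ᶠ n in atTop, ℓ n ⊥ / ℓ n ⊤ ≤ C := by
  obtain ⟨C, hC, -⟩ := EReal.lt_iff_exists_real_btwn.mp hB.1
  exact ⟨C, (eventually_lt_of_limsup_lt hC).mono fun n hn => (EReal.coe_lt_coe_iff.mp hn).le⟩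

lemma GlobalRelativeEigengap.exists_gap {ℓ : ℕ → Fin p → ℝ} (hB : GlobalRelativeEigengap ℓ) :
    ∃ δ > 1, ∀ᶠ n in atTop, ∀ i j : Fin p, (i : ℕ) + 1 = j → δ ≤ ℓ n i / ℓ n j := by
  obtain ⟨δ, hδ1, hδ⟩ := EReal.lt_iff_exists_real_btwn.mp hB.2
  refine ⟨δ, by exact_mod_cast hδ1, ?_⟩
  filter_upwards [eventually_lt_of_lt_liminf hδ] with n hn i j hij
  have h1 := hn.le.trans ((iInf_le _ i).trans ((iInf_le _ j).trans (iInf_le _ hij)))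
  exact EReal.coe_le_coe_iff.mp h1

variable {X U : ∀ n, Matrix (Fin n) (Fin p) ℝ} {ℓ : ℕ → Fin p → ℝ}
  {V : ℕ → Matrix (Fin p) (Fin p) ℝ}

lemma exists_relSV_bounds (hSVD : ∀ᶠ n in atTop, IsSVD (X n) (U n) (ℓ n) (V n))
    (hB : GlobalRelativeEigengap ℓ) :
    ∃ c > 0, ∀ᶠ n in atTop, ∀ k, c ≤ relSV (ℓ n) k ∧ relSV (ℓ n) k ≤ 1 := by
  obtain ⟨C, hC⟩ := hB.exists_condition_le
  -- The maximum with `1` makes the constant visibly positive.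
  refine ⟨(max C 1)⁻¹, by positivity, ?_⟩
  filter_upwards [hC, hSVD] with n hn h k
  have h0 := h.pos ⊥
  have ht := h.pos ⊤
  constructor
  · have h1 : ℓ n ⊥ ≤ max C 1 * ℓ n ⊤ := by
      rw [div_le_iff₀ ht] at hn
      exact hn.trans (mul_le_mul_of_nonneg_right (le_max_left _ _) ht.le)
    rw [relSV, inv_le_comm₀ (by positivity) (div_pos (h.pos k) h0), inv_div, div_le_iff₀ (h.pos k)]
    exact h1.trans (mul_le_mul_of_nonneg_left (h.antitone le_top) (by positivity))
  · rw [relSV, div_le_one h0]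
    exact h.antitone bot_le

/-- Subsequential limits of the relative singular values and of the right singular vectors. -/
lemma exists_svd_limits {α : Type*} {𝒰 : Ultrafilter α} {N : α → ℕ} (hN : Tendsto N 𝒰 atTop)
    (hSVD : ∀ᶠ n in atTop, IsSVD (X n) (U n) (ℓ n) (V n)) (hB : GlobalRelativeEigengap ℓ) :
    ∃ (ρ₀ : Fin p → ℝ) (V₀ : Matrix (Fin p) (Fin p) ℝ),
      Tendsto (fun x => relSV (ℓ (N x))) 𝒰 (𝓝 ρ₀) ∧ Tendsto (fun x => V (N x)) 𝒰 (𝓝 V₀) ∧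
      (∀ k, 0 < ρ₀ k) ∧ StrictAnti ρ₀ := by
  obtain ⟨c, hc, hb⟩ := exists_relSV_bounds hSVD hB
  obtain ⟨δ, hδ, hgap⟩ := hB.exists_gap
  obtain ⟨V₀, hV₀, -⟩ := exists_tendsto_orthogonal (𝒰 := 𝒰) (Q := fun x => V (N x))
    (hN.eventually (hSVD.mono fun n h => h.right_orth))
  have hex : ∀ k, ∃ L, Tendsto (fun x => relSV (ℓ (N x)) k) 𝒰 (𝓝 L) := fun k =>
    exists_tendsto_of_eventually_abs_le (K := 1) (hN.eventually (hb.mono fun n hn =>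
      abs_le.mpr ⟨by linarith [(hn k).1], (hn k).2⟩))
  choose ρ₀ hρ₀ using hex
  have hpos : ∀ k, 0 < ρ₀ k := fun k => hc.trans_le
    (ge_of_tendsto (hρ₀ k) (hN.eventually (hb.mono fun n hn => (hn k).1)))
  refine ⟨ρ₀, V₀, tendsto_pi_nhds.mpr hρ₀, hV₀, hpos, fun i j hij => ?_⟩
  -- The gap between `i` and `i + 1`, together with monotonicity from `i + 1` to `j`, separates any
  -- two indices by the factor `δ > 1`, and this survives in the limit.
  have hle : δ * ρ₀ j ≤ ρ₀ i := by
    suffices h : ∀ᶠ n in atTop, δ * relSV (ℓ n) j ≤ relSV (ℓ n) i from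
      le_of_tendsto_of_tendsto ((hρ₀ j).const_mul δ) (hρ₀ i) (hN.eventually h)
    filter_upwards [hgap, hSVD] with n hn h
    have hi1 : (i : ℕ) + 1 < p := lt_of_le_of_lt (Nat.succ_le_of_lt hij) j.2
    have h1 := hn i ⟨(i : ℕ) + 1, hi1⟩ rfl
    rw [le_div_iff₀ (h.pos _)] at h1
    have h2 : ℓ n j ≤ ℓ n ⟨(i : ℕ) + 1, hi1⟩ := h.antitone (Nat.succ_le_of_lt hij)
    have h3 : δ * ℓ n j ≤ ℓ n i :=
      (mul_le_mul_of_nonneg_left h2 (by linarith)).trans h1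
    simp only [relSV]
    rw [mul_div_assoc']
    exact div_le_div_of_nonneg_right h3 (h.pos ⊥).le
  nlinarith [hpos j]

variable {Ω : ℕ → Type*} {m : ℕ → ℕ} {τ : ℕ → ℝ}
  {S : ∀ n, Ω n → Matrix (Fin (m n)) (Fin n) ℝ}

/-- First-order expansion of the spectral decomposition of the sketched Gram matrix. -/
lemma sketched_expansion (hm : Tendsto m atTop atTop) (hτ : ∀ n, 0 < τ n)
    (hτm : Tendsto (fun n => τ n / (m n : ℝ)) atTop (𝓝 0))
    (hSVD : ∀ᶠ n in atTop, IsSVD (X n) (U n) (ℓ n) (V n))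
    {𝒰 : Ultrafilter (Σ n, Ω n)} (h𝒰 : Tendsto Sigma.fst (𝒰 : Filter (Σ n, Ω n)) atTop)
    {ρ₀ : Fin p → ℝ} (hρ : Tendsto (fun x : Σ n, Ω n => relSV (ℓ x.1)) 𝒰 (𝓝 ρ₀))
    (hpos : ∀ k, 0 < ρ₀ k) (hanti : StrictAnti ρ₀) {w₀ : Fin p × Fin p → ℝ}
    (hW : Tendsto (fun x : Σ n, Ω n => scaledError m τ S U x.1 x.2) 𝒰 (𝓝 w₀)) {i : Fin p}
    {v : (Σ n, Ω n) → Fin p → ℝ}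
    (hv : ∀ᶠ x in (𝒰 : Filter (Σ n, Ω n)),
      IsUnitEigenvector (sketchedGram (S x.1 x.2) (X x.1)) i (v x)) :
    (∀ k, Tendsto (fun x : Σ n, Ω n => eig (sketchedGram (S x.1 x.2) (X x.1)) k / ℓ x.1 ⊥ ^ 2) 𝒰
      (𝓝 (ρ₀ k ^ 2))) ∧
    Tendsto (fun x : Σ n, Ω n => (√(m x.1 : ℝ) * (√(τ x.1))⁻¹) *
      (eig (sketchedGram (S x.1 x.2) (X x.1)) i / ℓ x.1 ⊥ ^ 2 - relSV (ℓ x.1) i ^ 2)) 𝒰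
      (𝓝 (ρ₀ i ^ 2 * w₀ (i, i))) ∧
    ∃ σ : ℝ, (σ = 1 ∨ σ = -1) ∧
      Tendsto (fun x => (V x.1)ᵀ *ᵥ v x) 𝒰 (𝓝 (Pi.single i σ)) ∧
      (∀ k, k ≠ i → Tendsto (fun x => (√(m x.1 : ℝ) * (√(τ x.1))⁻¹) * ((V x.1)ᵀ *ᵥ v x) k) 𝒰
        (𝓝 (σ * (ρ₀ i * ρ₀ k / (ρ₀ i ^ 2 - ρ₀ k ^ 2) * w₀ (k, i))))) ∧
      Tendsto (fun x => (√(m x.1 : ℝ) * (√(τ x.1))⁻¹) * (((V x.1)ᵀ *ᵥ v x) i - σ)) 𝒰 (𝓝 0) := by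
  have hS := h𝒰.eventually hSVD
  have hWkl : ∀ k l, Tendsto (fun x : Σ n, Ω n => (√(m x.1 : ℝ) * (√(τ x.1))⁻¹) *
      (sketchedGram (S x.1 x.2) (U x.1) - 1) k l) 𝒰 (𝓝 (w₀ (k, l))) := fun k l =>
    tendsto_pi_nhds.mp hW (k, l)
  obtain ⟨h1, h2, σ, hσ, h3, h4, h5⟩ := eigen_expansion (𝒰 := 𝒰)
    (ρ := fun x => relSV (ℓ x.1)) (K := fun x => sketchedGram (S x.1 x.2) (U x.1))
    (W₀ := fun k l => w₀ (k, l)) (i := i) (w := fun x => (V x.1)ᵀ *ᵥ v x)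
    (fun x => sketchedGram_isHermitian _ _) hρ hpos hanti
    ((tendsto_scaling_atTop hm hτ hτm).comp h𝒰) hWkl
    (by filter_upwards [hS, hv] with x hx hvx using (hx.rotated_eigenvector hvx).1)
    (by filter_upwards [hS, hv] with x hx hvx using (hx.rotated_eigenvector hvx).2)
  have heig : ∀ k, ∀ᶠ x in (𝒰 : Filter (Σ n, Ω n)),
      eig (diagonal (relSV (ℓ x.1)) * sketchedGram (S x.1 x.2) (U x.1) *
        diagonal (relSV (ℓ x.1))) k = eig (sketchedGram (S x.1 x.2) (X x.1)) k / ℓ x.1 ⊥ ^ 2 := by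
    intro k
    filter_upwards [hS] with x hx
    rw [hx.eig_sketchedGram, mul_div_cancel_left₀ _ (pow_ne_zero 2 (hx.pos ⊥).ne')]
  refine ⟨fun k => (h1 k).congr' (heig k), h2.congr' ?_, σ, hσ, h3, h4, h5⟩
  filter_upwards [heig i] with x hx
  rw [hx]
  rfl

end Model

/-! ### Quadratic forms in one row of the error, and the asymptotic variance. -/

section RowVec

variable {p : ℕ}

/-- The vector `f` placed in the off-diagonal part of the `i`-th row. -/
def rowVec (i : Fin p) (f : Fin p → ℝ) : Fin p × Fin p → ℝ :=
  fun q => if q.1 = i ∧ q.2 ≠ i then f q.2 else 0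

lemma rowVec_dotProduct (i : Fin p) (f : Fin p → ℝ) (v : Fin p × Fin p → ℝ) :
    rowVec i f ⬝ᵥ v = ∑ k ∈ Finset.univ.filter (fun k => k ≠ i), f k * v (i, k) := by
  rw [dotProduct, Fintype.sum_prod_type, Finset.sum_eq_single i, Finset.sum_filter]
  · refine Finset.sum_congr rfl fun k _ => ?_
    simp only [rowVec, true_and, ite_mul, zero_mul]
  · intro j _ hj
    exact Finset.sum_eq_zero fun k _ => by simp [rowVec, hj]
  · simp

lemma rowVec_quadratic (i : Fin p) (f : Fin p → ℝ)
    (G : Matrix (Fin p × Fin p) (Fin p × Fin p) ℝ) :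
    rowVec i f ⬝ᵥ G *ᵥ rowVec i f = ∑ k ∈ Finset.univ.filter (fun k => k ≠ i),
      ∑ l ∈ Finset.univ.filter (fun l => l ≠ i), f k * f l * G (i, k) (i, l) := by
  rw [rowVec_dotProduct]
  refine Finset.sum_congr rfl fun k _ => ?_
  rw [mulVec, dotProduct_comm, rowVec_dotProduct, Finset.mul_sum]
  exact Finset.sum_congr rfl fun l _ => by ring

lemma dotProduct_Delta_mulVec (Ξ : Matrix (Fin p) (Fin p) ℝ) (w : Fin p → Fin p → ℝ)
    (G : Matrix (Fin p × Fin p) (Fin p × Fin p) ℝ) (i : Fin p) (c : Fin p → ℝ) :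
    c ⬝ᵥ Delta Ξ w G i *ᵥ c = ∑ k ∈ Finset.univ.filter (fun k => k ≠ i),
      ∑ l ∈ Finset.univ.filter (fun l => l ≠ i),
        eig Ξ i * √(eig Ξ k * eig Ξ l) / ((eig Ξ i - eig Ξ k) * (eig Ξ i - eig Ξ l)) *
          G (i, k) (i, l) * ((c ⬝ᵥ w k) * (c ⬝ᵥ w l)) := by
  simp only [Delta, sum_mulVec, dotProduct_sum]
  refine Finset.sum_congr rfl fun k _ => Finset.sum_congr rfl fun l _ => ?_
  have h : vecMulVec (w k) (w l) *ᵥ c = (c ⬝ᵥ w l) • w k := by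
    funext j
    simp only [mulVec, dotProduct, vecMulVec_apply, Pi.smul_apply, smul_eq_mul, Finset.sum_mul]
    exact Finset.sum_congr rfl fun _ _ => by ring
  rw [smul_mulVec, dotProduct_smul, smul_eq_mul, h, dotProduct_smul, smul_eq_mul,
    mul_comm (c ⬝ᵥ w k)]

/-- The scale-free coefficients of `Delta`. -/
lemma Delta_coeff_div {a b d s : ℝ} (hs : s ≠ 0) :
    a * √(b * d) / ((a - b) * (a - d)) =
      (a / s ^ 2) * √((b / s ^ 2) * (d / s ^ 2)) /
        ((a / s ^ 2 - b / s ^ 2) * (a / s ^ 2 - d / s ^ 2)) := by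
  have h1 : √((b / s ^ 2) * (d / s ^ 2)) = √(b * d) / s ^ 2 := by
    rw [div_mul_div_comm, Real.sqrt_div' _ (mul_self_nonneg _), Real.sqrt_mul_self (sq_nonneg s)]
  rw [h1, ← sub_div, ← sub_div, div_mul_div_comm, div_mul_div_comm,
    div_div_div_cancel_right₀ (mul_ne_zero (pow_ne_zero 2 hs) (pow_ne_zero 2 hs))]

/-- The coefficients of the first-order expansion of `c ⬝ᵥ v̂ i`. -/
def loading (ℓ : Fin p → ℝ) (V : Matrix (Fin p) (Fin p) ℝ) (c : Fin p → ℝ) (i : Fin p) :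
    Fin p → ℝ :=
  fun k => ℓ i * ℓ k / (ℓ i ^ 2 - ℓ k ^ 2) * (Vᵀ *ᵥ c) k

/-- The coefficients in `Delta` factor over `k` and `l`, because `√(ℓ k ^ 2 * ℓ l ^ 2) = ℓ k * ℓ l`.
This recognizes the variance as that of the functional obtained by linearizing the eigenvector. -/
lemma IsSVD.dotProduct_Delta_mulVec {n : ℕ} {X U : Matrix (Fin n) (Fin p) ℝ} {ℓ : Fin p → ℝ}
    {V : Matrix (Fin p) (Fin p) ℝ} (h : IsSVD X U ℓ V)
    (G : Matrix (Fin p × Fin p) (Fin p × Fin p) ℝ) (i : Fin p) (c : Fin p → ℝ) :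
    c ⬝ᵥ Delta (Xᵀ * X) V.col G i *ᵥ c =
      rowVec i (loading ℓ V c i) ⬝ᵥ G *ᵥ rowVec i (loading ℓ V c i) := by
  rw [SketchedPCA.dotProduct_Delta_mulVec, rowVec_quadratic]
  refine Finset.sum_congr rfl fun k _ => Finset.sum_congr rfl fun l _ => ?_
  have hc : ∀ k, c ⬝ᵥ V.col k = (Vᵀ *ᵥ c) k := fun k => dotProduct_comm _ _
  have hs : √(ℓ k ^ 2 * ℓ l ^ 2) = ℓ k * ℓ l := by
    rw [← mul_pow, Real.sqrt_sq (mul_pos (h.pos k) (h.pos l)).le]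
  rw [h.eig_gram, h.eig_gram, h.eig_gram, hc, hc, hs]
  simp only [loading, div_eq_mul_inv, mul_inv]
  ring

end RowVec

/-! ### Asymptotic normality of eigenvalues. -/

section EigenvalueCLT

variable {p : ℕ} [NeZero p] {Ω : ℕ → Type*} [∀ n, MeasurableSpace (Ω n)]
  {P : ∀ n, Measure (Ω n)} [∀ n, IsProbabilityMeasure (P n)]
  {m : ℕ → ℕ} {τ : ℕ → ℝ} {X U : ∀ n, Matrix (Fin n) (Fin p) ℝ} {ℓ : ℕ → Fin p → ℝ}
  {V : ℕ → Matrix (Fin p) (Fin p) ℝ} {S : ∀ n, Ω n → Matrix (Fin (m n)) (Fin n) ℝ}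
  {G : ℕ → Matrix (Fin p × Fin p) (Fin p × Fin p) ℝ}

lemma aemeasurable_eig_sketchedGram {p m n : ℕ} {Ω : Type*} [MeasurableSpace Ω] {μ : Measure Ω}
    {S : Ω → Matrix (Fin m) (Fin n) ℝ} (hS : ∀ a b, AEMeasurable (fun ω => S ω a b) μ)
    (X : Matrix (Fin n) (Fin p) ℝ) (k : Fin p) :
    AEMeasurable (fun ω => eig (sketchedGram (S ω) X) k) μ := by
  refine aemeasurable_eig (fun ω => sketchedGram_isHermitian _ _) (fun i j => ?_) k
  simp only [sketchedGram, mul_apply, transpose_apply]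
  fun_prop

lemma UniformlyNondegenerate.exists_limit {α ι : Type*} {G : ℕ → Matrix ι ι ℝ}
    (hG : UniformlyNondegenerate G) {𝒰 : Ultrafilter α} (N : α → ℕ) :
    ∃ G₀ : Matrix ι ι ℝ, (∀ q r, Tendsto (fun x => G (N x) q r) 𝒰 (𝓝 (G₀ q r))) ∧
      ∀ q, 0 < G₀ q q := by
  obtain ⟨c, C, hc, hcG, hCG⟩ := hG
  have hex : ∀ q r, ∃ L, Tendsto (fun x => G (N x) q r) 𝒰 (𝓝 L) := fun q r =>
    exists_tendsto_of_eventually_abs_le (.of_forall fun x => hCG (N x) q r)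
  choose G₀ hG₀ using hex
  exact ⟨Matrix.of G₀, hG₀, fun q => hc.trans_le (ge_of_tendsto' (hG₀ q q) fun x => hcG _ q)⟩

/-- Asymptotic normality of the relative errors of sketched eigenvalues. -/
theorem eigenvalue_convStdNormal (hm : Tendsto m atTop atTop) (hτ : ∀ n, 0 < τ n)
    (hτm : Tendsto (fun n => τ n / (m n : ℝ)) atTop (𝓝 0))
    (hSVD : ∀ᶠ n in atTop, IsSVD (X n) (U n) (ℓ n) (V n)) (hB : GlobalRelativeEigengap ℓ)
    (hS : ∀ n a b, AEMeasurable (fun ω => S n ω a b) (P n)) (hG : UniformlyNondegenerate G)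
    (hL : LinearCLT P (scaledError m τ S U) G) (i : Fin p) :
    ConvStdNormal P (fun n ω =>
      √((m n : ℝ) / (τ n * G n (i, i) (i, i))) * (eig (sketchedGram (S n ω) (X n)) i)⁻¹ *
        (eig (sketchedGram (S n ω) (X n)) i - eig ((X n)ᵀ * X n) i)) := by
  refine hL.convStdNormal hG (hG.exists_abs_single_le (i, i))
    (.of_forall fun n => hG.single_quadratic n (i, i)) (fun n => ?_) (good := fun _ _ => True)
    (.of_forall fun n => .of_forall fun ω => trivial) fun 𝒰 h𝒰 _ w₀ hw₀ => ?_
  · have h1 := aemeasurable_eig_sketchedGram (hS n) (X n) i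
    fun_prop
  · obtain ⟨ρ₀, V₀, hρ₀, -, hpos, hanti⟩ := exists_svd_limits h𝒰 hSVD hB
    obtain ⟨G₀, hG₀, hG₀pos⟩ := hG.exists_limit (𝒰 := 𝒰) Sigma.fst
    -- The statistic involves no eigenvector but the expansion needs one; any pointwise choice will
    -- do, as no measurability enters along the ultrafilter.
    choose v hv using fun x : Σ n, Ω n =>
      exists_isUnitEigenvector (sketchedGram_isHermitian (S x.1 x.2) (X x.1)) i
    obtain ⟨hμ, hdiff, -⟩ := sketched_expansion hm hτ hτm hSVD h𝒰 hρ₀ hpos hanti hw₀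
      (.of_forall hv)
    have hsq : Tendsto (fun x : Σ n, Ω n => (√(G x.1 (i, i) (i, i)))⁻¹) 𝒰
        (𝓝 (√(G₀ (i, i) (i, i)))⁻¹) :=
      (hG₀ (i, i) (i, i)).sqrt.inv₀ (Real.sqrt_pos.mpr (hG₀pos _)).ne'
    refine ⟨(√(G₀ (i, i) (i, i)))⁻¹ * w₀ (i, i), ?_, ?_⟩
    · have hρ2 : ρ₀ i ^ 2 ≠ 0 := pow_ne_zero 2 (hpos i).ne'
      have h1 := hsq.mul (hdiff.div (hμ i) hρ2)
      rw [mul_div_cancel_left₀ _ hρ2] at h1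
      refine h1.congr' ?_
      filter_upwards [h𝒰.eventually hSVD] with x hx
      have hl : ℓ x.1 ⊥ ^ 2 ≠ 0 := pow_ne_zero 2 (hx.pos ⊥).ne'
      have hroot : √((m x.1 : ℝ) / (τ x.1 * G x.1 (i, i) (i, i))) =
          (√(G x.1 (i, i) (i, i)))⁻¹ * (√(m x.1 : ℝ) * (√(τ x.1))⁻¹) := by
        rw [Real.sqrt_div (Nat.cast_nonneg _), Real.sqrt_mul (hτ x.1).le, div_eq_mul_inv, mul_inv]
        ring
      have hrel : eig (sketchedGram (S x.1 x.2) (X x.1)) i / ℓ x.1 ⊥ ^ 2 - relSV (ℓ x.1) i ^ 2 =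
          (eig (sketchedGram (S x.1 x.2) (X x.1)) i - ℓ x.1 i ^ 2) / ℓ x.1 ⊥ ^ 2 := by
        rw [relSV, div_pow, sub_div]
      rw [Pi.div_apply, hrel, hx.eig_gram, hroot, mul_div_assoc, div_div_div_cancel_right₀ hl]
      simp only [div_eq_mul_inv]
      ring
    · simp only [single_dotProduct]
      exact hsq.mul (tendsto_pi_nhds.mp hw₀ (i, i))

end EigenvalueCLT

/-! ### Resolution of the sign ambiguity. -/

section Signs

variable {p : ℕ} [NeZero p]

lemma FirstNonzeroPos.apply_zero_nonneg {w : Fin p → ℝ} (h : FirstNonzeroPos w) : 0 ≤ w 0 := by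
  obtain ⟨k, hk, hj⟩ := h
  by_cases h0 : k = 0
  · exact (h0 ▸ hk).le
  · exact (hj 0 (Fin.pos_iff_ne_zero.mpr h0)).ge

/-- Puts both conventions into one pointwise disjunction. Under the second, both first coordinates
are nonnegative, so the bound on `|v n 0|` bounds `v n 0` itself. -/
lemma SignsAgree.exists_pointwise {Ω : ℕ → Type*} [∀ n, MeasurableSpace (Ω n)]
    {P : ∀ n, Measure (Ω n)} {v : ℕ → Fin p → ℝ} {vhat : ∀ n, Ω n → Fin p → ℝ}
    (h : SignsAgree P v vhat) : ∃ δ > 0, ∀ᶠ n in atTop, ∀ᵐ ω ∂(P n),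
      0 ≤ v n ⬝ᵥ vhat n ω ∨ (0 ≤ vhat n ω 0 ∧ δ ≤ v n 0) := by
  rcases h with h | ⟨h, hlim⟩
  · exact ⟨1, one_pos, h.mono fun n hn => hn.mono fun ω hω => Or.inl hω⟩
  · obtain ⟨δ, hδ, hδlim⟩ := EReal.lt_iff_exists_real_btwn.mp hlim
    refine ⟨δ, by exact_mod_cast hδ, ?_⟩
    filter_upwards [h, eventually_lt_of_lt_liminf hδlim] with n hn hn2
    filter_upwards [hn.2] with ω hω
    have h1 : δ < |v n 0| := EReal.coe_lt_coe_iff.mp hn2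
    rw [abs_of_nonneg hn.1.apply_zero_nonneg] at h1
    exact Or.inr ⟨hω.apply_zero_nonneg, h1.le⟩

/-- In the limit `v` is `σ` times the `i`-th column of `V₀`. One of the two alternatives holds along
the ultrafilter: the first gives `σ ≥ 0` as the limit of inner products, the second gives `V₀ 0 i *
σ ≥ 0` with `V₀ 0 i ≥ δ > 0`. -/
lemma sign_eq_one {α : Type*} {𝒰 : Ultrafilter α} {V : α → Matrix (Fin p) (Fin p) ℝ}
    {V₀ : Matrix (Fin p) (Fin p) ℝ} (hVo : ∀ᶠ x in 𝒰, (V x)ᵀ * V x = 1)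
    (hV : Tendsto V 𝒰 (𝓝 V₀)) {v : α → Fin p → ℝ} {i : Fin p} {σ : ℝ} (hσ : σ = 1 ∨ σ = -1)
    (hw : Tendsto (fun x => (V x)ᵀ *ᵥ v x) 𝒰 (𝓝 (Pi.single i σ))) {δ : ℝ} (hδ : 0 < δ)
    (h : ∀ᶠ x in 𝒰, 0 ≤ (V x).col i ⬝ᵥ v x ∨ (0 ≤ v x 0 ∧ δ ≤ (V x).col i 0)) : σ = 1 := by
  have hVkl : ∀ k l, Tendsto (fun x => V x k l) 𝒰 (𝓝 (V₀ k l)) := fun k l =>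
    tendsto_pi_nhds.mp (tendsto_pi_nhds.mp hV k) l
  have hnonneg : 0 ≤ σ := by
    rcases Ultrafilter.eventually_or.mp h with h1 | h1
    · have h2 : Tendsto (fun x => (V x).col i ⬝ᵥ v x) 𝒰 (𝓝 σ) := by
        simpa using! tendsto_pi_nhds.mp hw i
      exact ge_of_tendsto h2 h1
    · have h2 : Tendsto (fun x => v x 0) 𝒰 (𝓝 (V₀ 0 i * σ)) := by
        have h3 : Tendsto (fun x => ∑ k, V x 0 k * ((V x)ᵀ *ᵥ v x) k) 𝒰
            (𝓝 (∑ k, V₀ 0 k * (Pi.single i σ : Fin p → ℝ) k)) :=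
          tendsto_finsetSum _ fun k _ => (hVkl 0 k).mul (tendsto_pi_nhds.mp hw k)
        have h4 : ∑ k, V₀ 0 k * (Pi.single i σ : Fin p → ℝ) k = V₀ 0 i * σ :=
          dotProduct_single _ _ _
        rw [h4] at h3
        refine h3.congr' ?_
        filter_upwards [hVo] with x hx
        have h5 : V x *ᵥ ((V x)ᵀ *ᵥ v x) = v x := by
          rw [mulVec_mulVec, mul_eq_one_comm.mp hx, one_mulVec]
        exact congrFun h5 0
      have h3 : 0 ≤ V₀ 0 i * σ := ge_of_tendsto h2 (h1.mono fun x hx => hx.1)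
      have h4 : δ ≤ V₀ 0 i := ge_of_tendsto (hVkl 0 i) (h1.mono fun x hx => hx.2)
      exact nonneg_of_mul_nonneg_right h3 (hδ.trans_le h4)
  rcases hσ with h1 | h1
  · exact h1
  · linarith

end Signs

/-! ### Asymptotic normality of linear functionals of eigenvectors. -/

section EigenvectorCLT

variable {p : ℕ}

lemma sq_sub_sq_ne_zero_of_strictAnti {ρ₀ : Fin p → ℝ} (hpos : ∀ k, 0 < ρ₀ k)
    (hanti : StrictAnti ρ₀) {i k : Fin p} (hk : k ≠ i) : ρ₀ i ^ 2 - ρ₀ k ^ 2 ≠ 0 := fun h => by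
  rw [sub_eq_zero, sq_eq_sq₀ (hpos i).le (hpos k).le] at h
  exact hk (hanti.injective h).symm

lemma tendsto_transpose_mulVec {α : Type*} {l : Filter α} {V : α → Matrix (Fin p) (Fin p) ℝ}
    {V₀ : Matrix (Fin p) (Fin p) ℝ} (hV : Tendsto V l (𝓝 V₀)) (c : Fin p → ℝ) (k : Fin p) :
    Tendsto (fun x => ((V x)ᵀ *ᵥ c) k) l (𝓝 ((V₀ᵀ *ᵥ c) k)) :=
  tendsto_finsetSum Finset.univ fun j _ =>
    (tendsto_pi_nhds.mp (tendsto_pi_nhds.mp hV j) k).mul_const (c j)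

variable [NeZero p]

/-- The limit of `loading` in terms of the limits of relative singular values and of `Vᵀ c`. -/
def limitLoading (ρ₀ : Fin p → ℝ) (V₀ : Matrix (Fin p) (Fin p) ℝ) (c : Fin p → ℝ) (i : Fin p) :
    Fin p → ℝ :=
  fun k => ρ₀ i * ρ₀ k / (ρ₀ i ^ 2 - ρ₀ k ^ 2) * (V₀ᵀ *ᵥ c) k

variable {X U : ∀ n, Matrix (Fin n) (Fin p) ℝ} {ℓ : ℕ → Fin p → ℝ}
  {V : ℕ → Matrix (Fin p) (Fin p) ℝ}

lemma tendsto_loading {α : Type*} {l : Filter α} {N : α → ℕ} (hN : Tendsto N l atTop)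
    (hSVD : ∀ᶠ n in atTop, IsSVD (X n) (U n) (ℓ n) (V n)) {ρ₀ : Fin p → ℝ}
    {V₀ : Matrix (Fin p) (Fin p) ℝ}
    (hρ : Tendsto (fun x => relSV (ℓ (N x))) l (𝓝 ρ₀)) (hV : Tendsto (fun x => V (N x)) l (𝓝 V₀))
    (hpos : ∀ k, 0 < ρ₀ k) (hanti : StrictAnti ρ₀) (c : Fin p → ℝ) {i k : Fin p} (hk : k ≠ i) :
    Tendsto (fun x => loading (ℓ (N x)) (V (N x)) c i k) l (𝓝 (limitLoading ρ₀ V₀ c i k)) := by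
  have hρk := tendsto_pi_nhds.mp hρ
  have h1 := ((((hρk i).mul (hρk k)).div (((hρk i).pow 2).sub ((hρk k).pow 2))
    (sq_sub_sq_ne_zero_of_strictAnti hpos hanti hk))).mul (tendsto_transpose_mulVec hV c k)
  refine h1.congr' ?_
  filter_upwards [hN.eventually hSVD] with x hx
  simp only [loading, hx.ratio_eq]
  rfl

lemma tendsto_loading_quadratic {α : Type*} {l : Filter α} {N : α → ℕ} (hN : Tendsto N l atTop)
    (hSVD : ∀ᶠ n in atTop, IsSVD (X n) (U n) (ℓ n) (V n)) {ρ₀ : Fin p → ℝ}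
    {V₀ : Matrix (Fin p) (Fin p) ℝ}
    (hρ : Tendsto (fun x => relSV (ℓ (N x))) l (𝓝 ρ₀)) (hV : Tendsto (fun x => V (N x)) l (𝓝 V₀))
    (hpos : ∀ k, 0 < ρ₀ k) (hanti : StrictAnti ρ₀) (c : Fin p → ℝ) (i : Fin p)
    {G : ℕ → Matrix (Fin p × Fin p) (Fin p × Fin p) ℝ}
    {G₀ : Matrix (Fin p × Fin p) (Fin p × Fin p) ℝ}
    (hG₀ : ∀ q r, Tendsto (fun x => G (N x) q r) l (𝓝 (G₀ q r))) :
    Tendsto (fun x => rowVec i (loading (ℓ (N x)) (V (N x)) c i) ⬝ᵥ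
      G (N x) *ᵥ rowVec i (loading (ℓ (N x)) (V (N x)) c i)) l
      (𝓝 (rowVec i (limitLoading ρ₀ V₀ c i) ⬝ᵥ G₀ *ᵥ rowVec i (limitLoading ρ₀ V₀ c i))) := by
  simp only [rowVec_quadratic]
  refine tendsto_finsetSum _ fun k hk => tendsto_finsetSum _ fun l hl => ?_
  exact ((tendsto_loading hN hSVD hρ hV hpos hanti c (Finset.mem_filter.mp hk).2).mul
    (tendsto_loading hN hSVD hρ hV hpos hanti c (Finset.mem_filter.mp hl).2)).mul (hG₀ _ _)

/-- Off-diagonal loadings converge along every ultrafilter tending to infinity, hence are bounded;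
the lower bound `δ` keeps the normalization from blowing up. -/
lemma exists_normalized_rowVec_le (hSVD : ∀ᶠ n in atTop, IsSVD (X n) (U n) (ℓ n) (V n))
    (hB : GlobalRelativeEigengap ℓ) (c : Fin p → ℝ) (i : Fin p)
    {D : ℕ → ℝ} {δ : ℝ} (hδ : 0 < δ) (hD : ∀ᶠ n in atTop, δ ≤ D n) :
    ∃ K, ∀ᶠ n in atTop, ∀ q, |((√(D n))⁻¹ • rowVec i (loading (ℓ n) (V n) c i)) q| ≤ K := by
  have hload : ∀ k, ∃ K, k ≠ i → ∀ᶠ n in atTop, |loading (ℓ n) (V n) c i k| ≤ K := fun k => by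
    by_cases hk : k = i
    · exact ⟨0, fun h => absurd hk h⟩
    · obtain ⟨K, hK⟩ := exists_eventually_abs_le_of_ultrafilter (l := (atTop : Filter ℕ))
        (f := fun n => loading (ℓ n) (V n) c i k) fun 𝒰 h𝒰 => by
          obtain ⟨ρ₀, V₀, hρ₀, hV₀, hpos, hanti⟩ :=
            exists_svd_limits (N := fun n : ℕ => n) (𝒰 := 𝒰) h𝒰 hSVD hB
          exact ⟨_, tendsto_loading (N := fun n : ℕ => n) h𝒰 hSVD hρ₀ hV₀ hpos hanti c hk⟩
      exact ⟨K, fun _ => hK⟩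
  choose K hK using hload
  refine ⟨(√δ)⁻¹ * ∑ k, |K k|, ?_⟩
  have hall : ∀ᶠ n in atTop, ∀ k, k ≠ i → |loading (ℓ n) (V n) c i k| ≤ K k :=
    eventually_all.mpr fun k => eventually_imp_distrib_left.mpr (hK k)
  filter_upwards [hall, hD] with n hn hDn q
  rw [Pi.smul_apply, smul_eq_mul, abs_mul, abs_of_nonneg (by positivity)]
  have h1 : (√(D n))⁻¹ ≤ (√δ)⁻¹ :=
    inv_anti₀ (Real.sqrt_pos.mpr hδ) (Real.sqrt_le_sqrt hDn)
  have h2 : |rowVec i (loading (ℓ n) (V n) c i) q| ≤ ∑ k, |K k| := by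
    unfold rowVec
    split_ifs with hq
    · exact ((hn q.2 hq.2).trans (le_abs_self _)).trans
        (Finset.single_le_sum (f := fun k => |K k|) (fun _ _ => abs_nonneg _) (Finset.mem_univ q.2))
    · rw [abs_zero]
      positivity
  exact mul_le_mul h1 h2 (abs_nonneg _) (by positivity)

variable {Ω : ℕ → Type*} {m : ℕ → ℕ} {τ : ℕ → ℝ}
  {S : ∀ n, Ω n → Matrix (Fin (m n)) (Fin n) ℝ}
  {G : ℕ → Matrix (Fin p × Fin p) (Fin p × Fin p) ℝ}

/-- Consistency of the plug-in variance `cᵀ Δ̂ c`. -/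
lemma tendsto_dotProduct_Delta_mulVec
    (hSVD : ∀ᶠ n in atTop, IsSVD (X n) (U n) (ℓ n) (V n))
    {𝒰 : Ultrafilter (Σ n, Ω n)} (h𝒰 : Tendsto Sigma.fst (𝒰 : Filter (Σ n, Ω n)) atTop)
    {ρ₀ : Fin p → ℝ} {V₀ : Matrix (Fin p) (Fin p) ℝ}
    (hV : Tendsto (fun x : Σ n, Ω n => V x.1) 𝒰 (𝓝 V₀))
    (hpos : ∀ k, 0 < ρ₀ k) (hanti : StrictAnti ρ₀)
    (hμ : ∀ k, Tendsto (fun x : Σ n, Ω n => eig (sketchedGram (S x.1 x.2) (X x.1)) k / ℓ x.1 ⊥ ^ 2)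
      𝒰 (𝓝 (ρ₀ k ^ 2)))
    {G₀ : Matrix (Fin p × Fin p) (Fin p × Fin p) ℝ}
    (hG₀ : ∀ q r, Tendsto (fun x : Σ n, Ω n => G x.1 q r) 𝒰 (𝓝 (G₀ q r)))
    {vhat : ∀ n, Ω n → Fin p → Fin p → ℝ} {σ : Fin p → ℝ}
    (hw : ∀ k, Tendsto (fun x : Σ n, Ω n => (V x.1)ᵀ *ᵥ vhat x.1 x.2 k) 𝒰
      (𝓝 (Pi.single k (σ k)))) {i : Fin p}
    (hσG : ∀ k l, k ≠ i → l ≠ i → σ k * σ l * G₀ (i, k) (i, l) = G₀ (i, k) (i, l))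
    (c : Fin p → ℝ) :
    Tendsto (fun x : Σ n, Ω n => c ⬝ᵥ Delta (sketchedGram (S x.1 x.2) (X x.1)) (vhat x.1 x.2)
      (G x.1) i *ᵥ c) 𝒰
      (𝓝 (rowVec i (limitLoading ρ₀ V₀ c i) ⬝ᵥ G₀ *ᵥ rowVec i (limitLoading ρ₀ V₀ c i))) := by
  have hcv : ∀ k, Tendsto (fun x : Σ n, Ω n => c ⬝ᵥ vhat x.1 x.2 k) 𝒰
      (𝓝 ((V₀ᵀ *ᵥ c) k * σ k)) := fun k => by
    have h1 : Tendsto (fun x : Σ n, Ω n => ((V x.1)ᵀ *ᵥ c) ⬝ᵥ ((V x.1)ᵀ *ᵥ vhat x.1 x.2 k)) 𝒰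
        (𝓝 ((V₀ᵀ *ᵥ c) ⬝ᵥ Pi.single k (σ k))) :=
      tendsto_finsetSum _ fun j _ =>
        (tendsto_transpose_mulVec hV c j).mul (tendsto_pi_nhds.mp (hw k) j)
    rw [dotProduct_single] at h1
    refine h1.congr' ?_
    filter_upwards [h𝒰.eventually hSVD] with x hx
    exact transpose_mulVec_dotProduct hx.right_orth _ _
  simp only [dotProduct_Delta_mulVec, rowVec_quadratic]
  refine tendsto_finsetSum _ fun k hk => tendsto_finsetSum _ fun l hl => ?_
  have hk' := (Finset.mem_filter.mp hk).2
  have hl' := (Finset.mem_filter.mp hl).2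
  have hne := mul_ne_zero (sq_sub_sq_ne_zero_of_strictAnti hpos hanti hk')
    (sq_sub_sq_ne_zero_of_strictAnti hpos hanti hl')
  have h1 := ((((hμ i).mul ((hμ k).mul (hμ l)).sqrt).div
    (((hμ i).sub (hμ k)).mul ((hμ i).sub (hμ l))) hne).mul (hG₀ (i, k) (i, l))).mul
      ((hcv k).mul (hcv l))
  have hlim : ρ₀ i ^ 2 * √(ρ₀ k ^ 2 * ρ₀ l ^ 2) /
      ((ρ₀ i ^ 2 - ρ₀ k ^ 2) * (ρ₀ i ^ 2 - ρ₀ l ^ 2)) * G₀ (i, k) (i, l) *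
      ((V₀ᵀ *ᵥ c) k * σ k * ((V₀ᵀ *ᵥ c) l * σ l)) =
      limitLoading ρ₀ V₀ c i k * limitLoading ρ₀ V₀ c i l * G₀ (i, k) (i, l) := by
    rw [← mul_pow, Real.sqrt_sq (mul_pos (hpos k) (hpos l)).le]
    simp only [limitLoading, div_eq_mul_inv, mul_inv]
    linear_combination (ρ₀ i ^ 2 * (ρ₀ k * ρ₀ l) * ((ρ₀ i ^ 2 - ρ₀ k ^ 2)⁻¹ *
      (ρ₀ i ^ 2 - ρ₀ l ^ 2)⁻¹) * (V₀ᵀ *ᵥ c) k * (V₀ᵀ *ᵥ c) l) * hσG k l hk' hl'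
  rw [hlim] at h1
  refine h1.congr' ?_
  filter_upwards [h𝒰.eventually hSVD] with x hx
  rw [Delta_coeff_div (hx.pos ⊥).ne']
  rfl

variable [∀ n, MeasurableSpace (Ω n)] {P : ∀ n, Measure (Ω n)} [∀ n, IsProbabilityMeasure (P n)]

/-- Asymptotic normality of linear functionals of sketched eigenvectors, studentized by the
plug-in variance. -/
theorem eigenvector_convStdNormal (hm : Tendsto m atTop atTop) (hτ : ∀ n, 0 < τ n)
    (hτm : Tendsto (fun n => τ n / (m n : ℝ)) atTop (𝓝 0))
    (hSVD : ∀ᶠ n in atTop, IsSVD (X n) (U n) (ℓ n) (V n)) (hB : GlobalRelativeEigengap ℓ)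
    (hG : UniformlyNondegenerate G) (hL : LinearCLT P (scaledError m τ S U) G) {i : Fin p}
    {vhat : ∀ n, Ω n → Fin p → Fin p → ℝ}
    (hvhat : ∀ n k, ∀ᵐ ω ∂(P n),
      IsUnitEigenvector (sketchedGram (S n ω) (X n)) k (vhat n ω k))
    (hsign : SignsAgree P (fun n => (V n).col i) (fun n ω => vhat n ω i))
    (hsigns : ∀ k l, k ≠ i → l ≠ i → k ≠ l →
      (SignsAgree P (fun n => (V n).col k) (fun n ω => vhat n ω k) ∧
        SignsAgree P (fun n => (V n).col l) (fun n ω => vhat n ω l)) ∨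
      ∀ n, G n (i, k) (i, l) = 0)
    {c : Fin p → ℝ} {δ : ℝ} (hδ : 0 < δ)
    (hD : ∀ᶠ n in atTop, δ ≤ rowVec i (loading (ℓ n) (V n) c i) ⬝ᵥ
      G n *ᵥ rowVec i (loading (ℓ n) (V n) c i))
    {T : ∀ n, Ω n → ℝ} (hT : ∀ n, AEMeasurable (T n) (P n))
    (hTeq : ∀ n ω, Function.Injective (eig (sketchedGram (S n ω) (X n))) →
      (∀ k, 0 < eig (sketchedGram (S n ω) (X n)) k) →
      T n ω = √(m n : ℝ) * (√(τ n))⁻¹ *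
        (√(c ⬝ᵥ Delta (sketchedGram (S n ω) (X n)) (vhat n ω) (G n) i *ᵥ c))⁻¹ *
        (c ⬝ᵥ (vhat n ω i - (V n).col i))) :
    ConvStdNormal P T := by
  have hex : ∀ k, ∃ δ > 0, SignsAgree P (fun n => (V n).col k) (fun n ω => vhat n ω k) →
      ∀ᶠ n in atTop, ∀ᵐ ω ∂(P n),
        0 ≤ (V n).col k ⬝ᵥ vhat n ω k ∨ (0 ≤ vhat n ω k 0 ∧ δ ≤ (V n).col k 0) := fun k => by
    by_cases h : SignsAgree P (fun n => (V n).col k) (fun n ω => vhat n ω k)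
    · obtain ⟨δ, hδ, h'⟩ := h.exists_pointwise
      exact ⟨δ, hδ, fun _ => h'⟩
    · exact ⟨1, one_pos, fun h' => absurd h' h⟩
  choose η hη hsgn using hex
  set D : ℕ → ℝ := fun n => rowVec i (loading (ℓ n) (V n) c i) ⬝ᵥ
    G n *ᵥ rowVec i (loading (ℓ n) (V n) c i) with hDdef
  refine hL.convStdNormal hG (B := fun n => (√(D n))⁻¹ • rowVec i (loading (ℓ n) (V n) c i))
    (exists_normalized_rowVec_le hSVD hB c i hδ hD) ?_ hT
    (good := fun n ω => (∀ k, IsUnitEigenvector (sketchedGram (S n ω) (X n)) k (vhat n ω k)) ∧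
      ∀ k, SignsAgree P (fun n => (V n).col k) (fun n ω => vhat n ω k) →
        0 ≤ (V n).col k ⬝ᵥ vhat n ω k ∨ (0 ≤ vhat n ω k 0 ∧ η k ≤ (V n).col k 0)) ?_ ?_
  · filter_upwards [hD] with n hn
    have hpos : 0 < D n := hδ.trans_le hn
    rw [mulVec_smul, smul_dotProduct, dotProduct_smul, smul_eq_mul, smul_eq_mul, ← mul_assoc,
      ← mul_inv, Real.mul_self_sqrt hpos.le]
    exact inv_mul_cancel₀ hpos.ne'
  · have h1 : ∀ᶠ n in atTop, ∀ k, SignsAgree P (fun n => (V n).col k) (fun n ω => vhat n ω k) →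
        ∀ᵐ ω ∂(P n), 0 ≤ (V n).col k ⬝ᵥ vhat n ω k ∨ (0 ≤ vhat n ω k 0 ∧ η k ≤ (V n).col k 0) :=
      eventually_all.mpr fun k => eventually_imp_distrib_left.mpr (hsgn k)
    filter_upwards [h1] with n hn
    have h2 := ae_all_iff.mpr fun k => eventually_imp_distrib_left.mpr (hn k)
    filter_upwards [ae_all_iff.mpr (hvhat n), h2] with ω hω1 hω2 using ⟨hω1, hω2⟩
  · intro 𝒰 h𝒰 hgood w₀ hw₀
    obtain ⟨ρ₀, V₀, hρ₀, hV₀, hpos, hanti⟩ := exists_svd_limits h𝒰 hSVD hB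
    obtain ⟨G₀, hG₀, -⟩ := hG.exists_limit (𝒰 := 𝒰) Sigma.fst
    have hexp := fun k => sketched_expansion hm hτ hτm hSVD h𝒰 hρ₀ hpos hanti hw₀
      (i := k) (v := fun x => vhat x.1 x.2 k) (hgood.mono fun x hx => hx.1 k)
    have hμ := (hexp i).1
    choose σ hσ hw hak hai using fun k => (hexp k).2.2
    have hσ1 : ∀ k, SignsAgree P (fun n => (V n).col k) (fun n ω => vhat n ω k) → σ k = 1 :=
      fun k hk => sign_eq_one (h𝒰.eventually (hSVD.mono fun n h => h.right_orth)) hV₀ (hσ k) (hw k)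
        (hη k) (hgood.mono fun x hx => hx.2 k hk)
    -- The plug-in variance sees the unknown signs only through products `σ k * σ l` weighted by
    -- `G`. These are harmless when `k = l`, when both signs are `+1`, or when the entry of `G`
    -- vanishes.
    have hσG : ∀ k l, k ≠ i → l ≠ i → σ k * σ l * G₀ (i, k) (i, l) = G₀ (i, k) (i, l) := by
      intro k l hk hl
      by_cases hkl : k = l
      · subst hkl
        rcases hσ k with h | h <;> rw [h] <;> ring
      · rcases hsigns k l hk hl hkl with ⟨h1, h2⟩ | h
        · rw [hσ1 k h1, hσ1 l h2]; ring
        · have h3 : G₀ (i, k) (i, l) = 0 :=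
            tendsto_nhds_unique (hG₀ _ _) (tendsto_const_nhds.congr fun x => (h x.1).symm)
          rw [h3, mul_zero]
    set D₀ := rowVec i (limitLoading ρ₀ V₀ c i) ⬝ᵥ G₀ *ᵥ rowVec i (limitLoading ρ₀ V₀ c i)
    have hDhat := tendsto_dotProduct_Delta_mulVec hSVD h𝒰 hV₀ hpos hanti hμ hG₀ hw hσG c
    have hDlim : Tendsto (fun x : Σ n, Ω n => D x.1) 𝒰 (𝓝 D₀) :=
      tendsto_loading_quadratic h𝒰 hSVD hρ₀ hV₀ hpos hanti c i hG₀
    have hD₀ : 0 < D₀ := hδ.trans_le (ge_of_tendsto hDlim (h𝒰.eventually hD))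
    have hsqrt : √D₀ ≠ 0 := (Real.sqrt_pos.mpr hD₀).ne'
    refine ⟨(√D₀)⁻¹ * ∑ k ∈ Finset.univ.filter (fun k => k ≠ i),
      limitLoading ρ₀ V₀ c i k * w₀ (i, k), ?_, ?_⟩
    · have hlin : Tendsto (fun x : Σ n, Ω n => (√(m x.1 : ℝ) * (√(τ x.1))⁻¹) *
          (c ⬝ᵥ (vhat x.1 x.2 i - (V x.1).col i))) 𝒰
          (𝓝 (∑ k ∈ Finset.univ.filter (fun k => k ≠ i),
            limitLoading ρ₀ V₀ c i k * w₀ (i, k))) := by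
        -- The error is expanded in the basis of columns of `V`, where `(V n).col i` becomes a basis
        -- vector; the component along it is negligible because the sign is `+1`.
        have h1 : ∀ k, Tendsto (fun x : Σ n, Ω n => ((V x.1)ᵀ *ᵥ c) k *
            ((√(m x.1 : ℝ) * (√(τ x.1))⁻¹) * (((V x.1)ᵀ *ᵥ vhat x.1 x.2 i) k -
              (Pi.single i 1 : Fin p → ℝ) k))) 𝒰
            (𝓝 (if k ≠ i then limitLoading ρ₀ V₀ c i k * w₀ (i, k) else 0)) := by
          intro k
          by_cases hk : k = i
          · subst hk
            have h2 := (tendsto_transpose_mulVec hV₀ c k).mul (hai k)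
            rw [hσ1 k hsign, mul_zero] at h2
            simpa using h2
          · have h2 := (tendsto_transpose_mulVec hV₀ c k).mul (hak i k hk)
            rw [hσ1 i hsign, one_mul, scaledError_limit_symm hw₀ k i] at h2
            rw [if_pos hk]
            have h3 : (V₀ᵀ *ᵥ c) k * (ρ₀ i * ρ₀ k / (ρ₀ i ^ 2 - ρ₀ k ^ 2) * w₀ (i, k)) =
                limitLoading ρ₀ V₀ c i k * w₀ (i, k) := by
              simp only [limitLoading]; ring
            rw [h3] at h2
            simpa only [Pi.single_eq_of_ne hk, sub_zero] using h2
        have h2 := tendsto_finsetSum Finset.univ fun k _ => h1 k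
        rw [← Finset.sum_filter] at h2
        refine h2.congr' ?_
        filter_upwards [h𝒰.eventually hSVD] with x hx
        have h3 : c ⬝ᵥ (V x.1).col i = ((V x.1)ᵀ *ᵥ c) ⬝ᵥ (Pi.single i 1 : Fin p → ℝ) := by
          rw [dotProduct_single, mul_one]
          exact dotProduct_comm _ _
        rw [dotProduct_sub, h3, ← transpose_mulVec_dotProduct hx.right_orth c, ← dotProduct_sub,
          dotProduct, Finset.mul_sum]
        exact Finset.sum_congr rfl fun k _ => by rw [Pi.sub_apply]; ring
      have h1 := ((hDhat.sqrt).inv₀ hsqrt).mul hlin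
      refine h1.congr' ?_
      -- The rescaled eigenvalues have distinct positive limits, so the conventions of `T` for
      -- degenerate spectra never matter along the ultrafilter.
      have hinj : ∀ᶠ x in (𝒰 : Filter (Σ n, Ω n)), ∀ k l, k ≠ l →
          eig (sketchedGram (S x.1 x.2) (X x.1)) k ≠ eig (sketchedGram (S x.1 x.2) (X x.1)) l := by
        refine eventually_all.mpr fun k => eventually_all.mpr fun l =>
          eventually_imp_distrib_left.mpr fun hkl => ?_
        have h2 := ((hμ k).sub (hμ l)).eventually_ne
          (sq_sub_sq_ne_zero_of_strictAnti hpos hanti hkl.symm)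
        filter_upwards [h2] with x hx h3
        rw [h3, sub_self] at hx
        exact hx rfl
      have hposev : ∀ᶠ x in (𝒰 : Filter (Σ n, Ω n)), ∀ k,
          0 < eig (sketchedGram (S x.1 x.2) (X x.1)) k / ℓ x.1 ⊥ ^ 2 :=
        eventually_all.mpr fun k => (hμ k).eventually_const_lt (pow_pos (hpos k) 2)
      filter_upwards [hinj, hposev, h𝒰.eventually hSVD] with x hx1 hx2 hx3
      rw [hTeq x.1 x.2 (fun k l h => by_contra fun hkl => hx1 k l hkl h)
        fun k => (div_pos_iff_of_pos_right (pow_pos (hx3.pos ⊥) 2)).mp (hx2 k)]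
      ring
    · have h1 : Tendsto (fun x : Σ n, Ω n => ∑ k ∈ Finset.univ.filter (fun k => k ≠ i),
          loading (ℓ x.1) (V x.1) c i k * scaledError m τ S U x.1 x.2 (i, k)) 𝒰
          (𝓝 (∑ k ∈ Finset.univ.filter (fun k => k ≠ i),
            limitLoading ρ₀ V₀ c i k * w₀ (i, k))) :=
        tendsto_finsetSum _ fun k hk =>
          (tendsto_loading h𝒰 hSVD hρ₀ hV₀ hpos hanti c (Finset.mem_filter.mp hk).2).mul
            (tendsto_pi_nhds.mp hw₀ (i, k))
      refine (((hDlim.sqrt).inv₀ hsqrt).mul h1).congr fun x => ?_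
      rw [smul_dotProduct, rowVec_dotProduct, smul_eq_mul]

end EigenvectorCLT

/-! ### Measurability, the isotropic covariance, and the main theorem. -/

section Assembly

variable {p : ℕ}

lemma aemeasurable_invSqrtDelta {m n : ℕ} {Ω : Type*} [MeasurableSpace Ω] {μ : Measure Ω}
    {S : Ω → Matrix (Fin m) (Fin n) ℝ} (hS : ∀ a b, AEMeasurable (fun ω => S ω a b) μ)
    (X : Matrix (Fin n) (Fin p) ℝ) {vhat : Ω → Fin p → Fin p → ℝ}
    (hv : ∀ k, AEMeasurable (fun ω => vhat ω k) μ)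
    (G : Matrix (Fin p × Fin p) (Fin p × Fin p) ℝ) (i : Fin p) (c : Fin p → ℝ) :
    AEMeasurable (fun ω => invSqrtDelta (sketchedGram (S ω) X) (vhat ω) G i c) μ := by
  classical
  have hE := aemeasurable_eig_sketchedGram hS X
  have hcv : ∀ k, AEMeasurable (fun ω => c ⬝ᵥ vhat ω k) μ := fun k =>
    Finset.aemeasurable_fun_sum _ fun j _ => (aemeasurable_pi_iff.mp (hv k) j).const_mul (c j)
  have hset : MeasurableSet {e : Fin p → ℝ | Function.Injective e} := by
    have h1 : {e : Fin p → ℝ | Function.Injective e} =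
        ⋂ (k : Fin p) (l : Fin p) (_ : k ≠ l), {e : Fin p → ℝ | e k = e l}ᶜ := by
      ext e
      simp only [Set.mem_iInter, Set.mem_compl_iff, Set.mem_ofPred_eq]
      exact ⟨fun h k l hkl he => hkl (h he), fun h k l he => by_contra fun hkl => h k l hkl he⟩
    rw [h1]
    exact MeasurableSet.iInter fun k => MeasurableSet.iInter fun l => MeasurableSet.iInter fun _ =>
      (measurableSet_eq_fun (measurable_pi_apply k) (measurable_pi_apply l)).compl
  -- The indicator of a simple spectrum, used as a factor, realizes the convention that the value is
  -- `0` at repeated eigenvalues.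
  have hind : AEMeasurable (fun ω => {e : Fin p → ℝ | Function.Injective e}.indicator
      (fun _ => (1 : ℝ)) (eig (sketchedGram (S ω) X))) μ :=
    (measurable_const.indicator hset).comp_aemeasurable (aemeasurable_pi_iff.mpr hE)
  have hquad : AEMeasurable
      (fun ω => c ⬝ᵥ Delta (sketchedGram (S ω) X) (vhat ω) G i *ᵥ c) μ := by
    simp only [dotProduct_Delta_mulVec]
    refine Finset.aemeasurable_fun_sum _ fun k _ => Finset.aemeasurable_fun_sum _ fun l _ => ?_
    have h1 := hE i
    have h2 := hE k
    have h3 := hE l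
    have h4 := hcv k
    have h5 := hcv l
    fun_prop
  refine (hind.mul hquad.sqrt.inv).congr (.of_forall fun ω => ?_)
  simp only [invSqrtDelta, Pi.mul_apply, Set.indicator_apply, Set.mem_ofPred_eq, ite_mul, one_mul,
    zero_mul, Pi.inv_apply]

/-- Off the diagonal, `P_p` pairs row `i` only with column `i` and `Q_p` vanishes, so only the
identity contributes. -/
lemma isotropic_apply_row (α : ℝ) {i k l : Fin p} (hk : k ≠ i) :
    (1 + Pmat p + α • Qmat p) (i, k) (i, l) = if k = l then 1 else 0 := by
  rw [isotropic_apply]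
  simp [hk, hk.symm]

lemma isotropic_apply_diag (α : ℝ) (i : Fin p) :
    (1 + Pmat p + α • Qmat p) (i, i) (i, i) = 2 + α := by
  rw [isotropic_apply]
  simp
  norm_num

lemma isotropic_rowVec_quadratic (α : ℝ) (i : Fin p) (f : Fin p → ℝ) :
    rowVec i f ⬝ᵥ (1 + Pmat p + α • Qmat p) *ᵥ rowVec i f =
      ∑ k ∈ Finset.univ.filter (fun k => k ≠ i), f k ^ 2 := by
  rw [rowVec_quadratic]
  refine Finset.sum_congr rfl fun k hk => ?_
  rw [Finset.sum_eq_single k]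
  · rw [isotropic_apply_row α (Finset.mem_filter.mp hk).2, if_pos rfl]
    ring
  · intro l _ hl
    rw [isotropic_apply_row α (Finset.mem_filter.mp hk).2, if_neg hl.symm, mul_zero]
  · exact fun h => absurd hk h

/-- Only the terms `k = l` remain, and positivity of the eigenvalues turns `√(eig Ξ k * eig Ξ k)`
into `eig Ξ k`. -/
lemma isotropic_dotProduct_Delta_mulVec {Ξ : Matrix (Fin p) (Fin p) ℝ} (hΞ : ∀ k, 0 < eig Ξ k)
    (α : ℝ) (w : Fin p → Fin p → ℝ) (i : Fin p) (c : Fin p → ℝ) :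
    c ⬝ᵥ Delta Ξ w (1 + Pmat p + α • Qmat p) i *ᵥ c =
      ∑ k ∈ Finset.univ.filter (fun k => k ≠ i),
        eig Ξ i * eig Ξ k / (eig Ξ i - eig Ξ k) ^ 2 * (c ⬝ᵥ w k) ^ 2 := by
  rw [dotProduct_Delta_mulVec]
  refine Finset.sum_congr rfl fun k hk => ?_
  rw [Finset.sum_eq_single k]
  · rw [isotropic_apply_row α (Finset.mem_filter.mp hk).2, if_pos rfl,
      Real.sqrt_mul_self (hΞ k).le]
    ring
  · intro l _ hl
    rw [isotropic_apply_row α (Finset.mem_filter.mp hk).2, if_neg hl.symm, mul_zero, zero_mul]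
  · exact fun h => absurd hk h

variable [NeZero p] {X U : ∀ n, Matrix (Fin n) (Fin p) ℝ} {ℓ : ℕ → Fin p → ℝ}
  {V : ℕ → Matrix (Fin p) (Fin p) ℝ}

lemma eventually_relSV_sq_sub_sq_ne_zero (hSVD : ∀ᶠ n in atTop, IsSVD (X n) (U n) (ℓ n) (V n))
    (hB : GlobalRelativeEigengap ℓ) {i k : Fin p} (hk : k ≠ i) :
    ∀ᶠ n in atTop, relSV (ℓ n) i ^ 2 - relSV (ℓ n) k ^ 2 ≠ 0 := by
  refine mem_iff_ultrafilter.mpr fun 𝒰 h𝒰 => ?_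
  obtain ⟨ρ₀, V₀, hρ₀, -, hpos, hanti⟩ :=
    exists_svd_limits (N := fun n : ℕ => n) (𝒰 := 𝒰) h𝒰 hSVD hB
  have hρk := tendsto_pi_nhds.mp hρ₀
  exact (((hρk i).pow 2).sub ((hρk k).pow 2)).eventually_ne
    (sq_sub_sq_ne_zero_of_strictAnti hpos hanti hk)

/-- The limiting variance is bounded below when `c` stays away from the `i`-th eigenvector. -/
lemma exists_le_sum_loading_sq (hSVD : ∀ᶠ n in atTop, IsSVD (X n) (U n) (ℓ n) (V n))
    (hB : GlobalRelativeEigengap ℓ) {c : Fin p → ℝ} (hc : c ⬝ᵥ c = 1) (i : Fin p)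
    (hlim : limsup (fun n => (((c ⬝ᵥ (V n).col i) ^ 2 : ℝ) : EReal)) atTop < 1) :
    ∃ δ > 0, ∀ᶠ n in atTop, δ ≤ ∑ k ∈ Finset.univ.filter (fun k => k ≠ i),
      loading (ℓ n) (V n) c i k ^ 2 := by
  obtain ⟨r, hr, hr1⟩ := EReal.lt_iff_exists_real_btwn.mp hlim
  have hr1' : r < 1 := by exact_mod_cast hr1
  obtain ⟨κ, hκ, hb⟩ := exists_relSV_bounds hSVD hB
  -- Each squared coefficient is at least `(κ * κ) ^ 2`, as its numerator is at least that and its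
  -- denominator at most one; the squared coordinates of `c` off the `i`-th axis sum to more than `1
  -- - r`.
  refine ⟨(κ * κ) ^ 2 * (1 - r), mul_pos (by positivity) (by linarith), ?_⟩
  have hne : ∀ᶠ n in atTop, ∀ k, k ≠ i → relSV (ℓ n) i ^ 2 - relSV (ℓ n) k ^ 2 ≠ 0 :=
    eventually_all.mpr fun k => eventually_imp_distrib_left.mpr fun hk =>
      eventually_relSV_sq_sub_sq_ne_zero hSVD hB hk
  filter_upwards [hSVD, hb, hne, eventually_lt_of_limsup_lt hr] with n h hbn hnen hrn
  have hrn' : ((V n)ᵀ *ᵥ c) i ^ 2 < r := by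
    have h1 : (c ⬝ᵥ (V n).col i) ^ 2 < r := EReal.coe_lt_coe_iff.mp hrn
    rwa [dotProduct_comm] at h1
  have hsum : ((V n)ᵀ *ᵥ c) i ^ 2 +
      ∑ k ∈ Finset.univ.filter (fun k => k ≠ i), ((V n)ᵀ *ᵥ c) k ^ 2 = 1 := by
    have h1 := transpose_mulVec_dotProduct h.right_orth c c
    rw [hc, dotProduct, ← Finset.add_sum_erase _ _ (Finset.mem_univ i)] at h1
    rw [← h1, Finset.filter_ne' Finset.univ i]
    simp only [pow_two]
  have hcoef : ∀ k ∈ Finset.univ.filter (fun k => k ≠ i),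
      (κ * κ) ^ 2 * ((V n)ᵀ *ᵥ c) k ^ 2 ≤ loading (ℓ n) (V n) c i k ^ 2 := by
    intro k hk
    have hk' := (Finset.mem_filter.mp hk).2
    rw [loading, h.ratio_eq, mul_pow _ (((V n)ᵀ *ᵥ c) k), div_pow]
    refine mul_le_mul_of_nonneg_right ?_ (sq_nonneg _)
    have hden : 0 < (relSV (ℓ n) i ^ 2 - relSV (ℓ n) k ^ 2) ^ 2 := by
      have := hnen k hk'
      positivity
    have hden1 : (relSV (ℓ n) i ^ 2 - relSV (ℓ n) k ^ 2) ^ 2 ≤ 1 := by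
      have hi := hbn i
      have hk2 := hbn k
      have h1 : relSV (ℓ n) i ^ 2 ≤ 1 := pow_le_one₀ (hκ.le.trans hi.1) hi.2
      have h2 : relSV (ℓ n) k ^ 2 ≤ 1 := pow_le_one₀ (hκ.le.trans hk2.1) hk2.2
      rw [sq_le_one_iff_abs_le_one, abs_le]
      constructor <;> nlinarith [sq_nonneg (relSV (ℓ n) i), sq_nonneg (relSV (ℓ n) k)]
    have hnum : (κ * κ) ^ 2 ≤ (relSV (ℓ n) i * relSV (ℓ n) k) ^ 2 :=
      pow_le_pow_left₀ (by positivity)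
        (mul_le_mul (hbn i).1 (hbn k).1 hκ.le (hκ.le.trans (hbn i).1)) 2
    rw [le_div_iff₀ hden]
    calc (κ * κ) ^ 2 * (relSV (ℓ n) i ^ 2 - relSV (ℓ n) k ^ 2) ^ 2
        ≤ (κ * κ) ^ 2 * 1 := mul_le_mul_of_nonneg_left hden1 (by positivity)
      _ ≤ (relSV (ℓ n) i * relSV (ℓ n) k) ^ 2 := by rw [mul_one]; exact hnum
  calc (κ * κ) ^ 2 * (1 - r)
      ≤ (κ * κ) ^ 2 * ∑ k ∈ Finset.univ.filter (fun k => k ≠ i), ((V n)ᵀ *ᵥ c) k ^ 2 :=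
        mul_le_mul_of_nonneg_left (by linarith) (by positivity)
    _ ≤ _ := by
        rw [Finset.mul_sum]
        exact Finset.sum_le_sum hcoef

end Assembly

end SketchedPCA

end

theorem theorem2 {p : ℕ} [NeZero p] {Ω : ℕ → Type*} [∀ n, MeasurableSpace (Ω n)]
    (P : ∀ n, Measure (Ω n)) [∀ n, IsProbabilityMeasure (P n)]
    (m : ℕ → ℕ) (hm : Tendsto m atTop atTop) (hmn : ∀ᶠ n in atTop, m n < n)
    (τ : ℕ → ℝ) (hτ : ∀ n, 0 < τ n) (hτm : Tendsto (fun n => τ n / (m n : ℝ)) atTop (𝓝 0))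
    (X U : ∀ n, Matrix (Fin n) (Fin p) ℝ) (ℓ : ℕ → Fin p → ℝ)
    (V : ℕ → Matrix (Fin p) (Fin p) ℝ)
    (hSVD : ∀ᶠ n in atTop, IsSVD (X n) (U n) (ℓ n) (V n))
    (hB : GlobalRelativeEigengap ℓ)
    (S : ∀ n, Ω n → Matrix (Fin (m n)) (Fin n) ℝ)
    (hS : ∀ n a b, AEMeasurable (fun ω => S n ω a b) (P n)) :
    (∀ G : ℕ → Matrix (Fin p × Fin p) (Fin p × Fin p) ℝ, SymNormality P m τ S U G → ∀ i : Fin p,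
      ConvStdNormal P (fun n ω =>
        √((m n : ℝ) / (τ n * G n (i, i) (i, i))) * (eig (sketchedGram (S n ω) (X n)) i)⁻¹ *
          (eig (sketchedGram (S n ω) (X n)) i - eig ((X n)ᵀ * X n) i)) ∧
      ∀ vhat : ∀ n, Ω n → Fin p → Fin p → ℝ,
        (∀ n k, AEMeasurable (fun ω => vhat n ω k) (P n)) →
        (∀ n k, ∀ᵐ ω ∂(P n),
          IsUnitEigenvector (sketchedGram (S n ω) (X n)) k (vhat n ω k)) →
        (∀ k, SignsAgree P (fun n => (V n).col k) (fun n ω => vhat n ω k)) →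
        ∀ c : Fin p → ℝ, c ⬝ᵥ c = 1 →
        0 < liminf (fun n =>
          ((c ⬝ᵥ Delta ((X n)ᵀ * X n) (V n).col (G n) i *ᵥ c : ℝ) : EReal)) atTop →
        ConvStdNormal P (fun n ω =>
          √(m n : ℝ) * (√(τ n))⁻¹ *
            invSqrtDelta (sketchedGram (S n ω) (X n)) (vhat n ω) (G n) i c *
            (c ⬝ᵥ (vhat n ω i - (V n).col i)))) ∧
    (∀ α : ℝ, α = 0 ∨ α = 1 → SymNormalityIso P m τ S U α → ∀ i : Fin p,
      ConvStdNormal P (fun n ω =>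
        √((m n : ℝ) / ((2 + α) * τ n)) * (eig (sketchedGram (S n ω) (X n)) i)⁻¹ *
          (eig (sketchedGram (S n ω) (X n)) i - eig ((X n)ᵀ * X n) i)) ∧
      ∀ vhat : ∀ n, Ω n → Fin p → Fin p → ℝ,
        (∀ n k, AEMeasurable (fun ω => vhat n ω k) (P n)) →
        (∀ n k, ∀ᵐ ω ∂(P n),
          IsUnitEigenvector (sketchedGram (S n ω) (X n)) k (vhat n ω k)) →
        SignsAgree P (fun n => (V n).col i) (fun n ω => vhat n ω i) →
        ∀ c : Fin p → ℝ, c ⬝ᵥ c = 1 →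
        limsup (fun n => (((c ⬝ᵥ (V n).col i) ^ 2 : ℝ) : EReal)) atTop < 1 →
        ConvStdNormal P (fun n ω =>
          √((m n : ℝ) / τ n) *
            (√(∑ k ∈ Finset.univ.filter (fun k => k ≠ i),
              eig (sketchedGram (S n ω) (X n)) i * eig (sketchedGram (S n ω) (X n)) k /
                (eig (sketchedGram (S n ω) (X n)) i - eig (sketchedGram (S n ω) (X n)) k) ^ 2 *
                (c ⬝ᵥ vhat n ω k) ^ 2))⁻¹ *
            (c ⬝ᵥ (vhat n ω i - (V n).col i)))) := by
  constructor
  · intro G hG i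
    have hGu := uniformlyNondegenerate_of_bounds hG.absSymm hG.bounds
    have hL : LinearCLT P (scaledError m τ S U) G := hG.linearCLT hτ
    refine ⟨eigenvalue_convStdNormal hm hτ hτm hSVD hB hS hGu hL i, ?_⟩
    intro vhat hvm hvhat hsign c _ hlim
    obtain ⟨δ, hδ, hδlim⟩ := EReal.lt_iff_exists_real_btwn.mp hlim
    refine eigenvector_convStdNormal hm hτ hτm hSVD hB hGu hL hvhat (hsign i)
      (fun k l _ _ _ => Or.inl ⟨hsign k, hsign l⟩) (c := c) (δ := δ) (by exact_mod_cast hδ) ?_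
      (fun n => ?_) fun n ω hinj _ => ?_
    · filter_upwards [hSVD, eventually_lt_of_lt_liminf hδlim] with n h hn
      rw [← h.dotProduct_Delta_mulVec]
      exact (EReal.coe_lt_coe_iff.mp hn).le
    · refine ((aemeasurable_invSqrtDelta (hS n) (X n) (hvm n) (G n) i c).const_mul _).mul ?_
      exact Finset.aemeasurable_fun_sum _ fun j _ =>
        ((aemeasurable_pi_iff.mp (hvm n i) j).sub_const _).const_mul (c j)
    · rw [invSqrtDelta, if_pos hinj]
  · intro α hα hS' i
    have hα0 : 0 ≤ α := by rcases hα with h | h <;> rw [h]; norm_num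
    have hGu := isotropic_uniformlyNondegenerate (p := p) hα0
    have hL : LinearCLT P (scaledError m τ S U) (fun _ => 1 + Pmat p + α • Qmat p) :=
      hS'.linearCLT hα0
    refine ⟨?_, ?_⟩
    · have h := eigenvalue_convStdNormal hm hτ hτm hSVD hB hS hGu hL i
      simpa only [isotropic_apply_diag, mul_comm (τ _)] using h
    · intro vhat hvm hvhat hsign c hc hlim
      obtain ⟨δ, hδ, hD⟩ := exists_le_sum_loading_sq hSVD hB hc i hlim
      -- Only the sign of the `i`-th eigenvector is controlled; for the other pairs `k ≠ l` the
      -- covariance entry is zero.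
      refine eigenvector_convStdNormal hm hτ hτm hSVD hB hGu hL hvhat hsign
        (fun k l hk _ hkl => Or.inr fun _ => by rw [isotropic_apply_row α hk, if_neg hkl])
        (c := c) hδ ?_ (fun n => ?_) fun n ω _ hpos => ?_
      · filter_upwards [hD] with n hn
        rwa [isotropic_rowVec_quadratic]
      · have hE := aemeasurable_eig_sketchedGram (hS n) (X n)
        have hcv : ∀ k, AEMeasurable (fun ω => c ⬝ᵥ vhat n ω k) (P n) := fun k =>
          Finset.aemeasurable_fun_sum _ fun j _ =>
            (aemeasurable_pi_iff.mp (hvm n k) j).const_mul (c j)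
        have hlin : AEMeasurable (fun ω => c ⬝ᵥ (vhat n ω i - (V n).col i)) (P n) :=
          Finset.aemeasurable_fun_sum _ fun j _ =>
            ((aemeasurable_pi_iff.mp (hvm n i) j).sub_const _).const_mul (c j)
        have hsum : AEMeasurable (fun ω => ∑ k ∈ Finset.univ.filter (fun k => k ≠ i),
            eig (sketchedGram (S n ω) (X n)) i * eig (sketchedGram (S n ω) (X n)) k /
              (eig (sketchedGram (S n ω) (X n)) i - eig (sketchedGram (S n ω) (X n)) k) ^ 2 *
              (c ⬝ᵥ vhat n ω k) ^ 2) (P n) := by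
          refine Finset.aemeasurable_fun_sum _ fun k _ => ?_
          have h1 := hE i
          have h2 := hE k
          have h3 := hcv k
          fun_prop
        exact ((hsum.sqrt.inv).const_mul _).mul hlin
      · rw [isotropic_dotProduct_Delta_mulVec hpos, Real.sqrt_div (Nat.cast_nonneg _),
          div_eq_mul_inv]
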